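/- Let $w[k]=\begin{bmatrix}x[k]^\top & y[k]^\top & z[k]^\top\end{bmatrix}^\top$, $k\in\mathbb Z$, be a stationary, zero-mean, Gaussian process of real random vectors, with autocovariance $R[k]=\mathbb E[w[i+k]w[i]^\top]$ and power spectral density $\Phi(\zeta)=\sum_{k\in\mathbb Z}\zeta^{-k}R[k]$ (absolutely convergent for $|\zeta|=1$). Assume that $\Phi$ is rational and that there are constants $c_{\min},c_{\max}>0$ with $c_{\min}I\preceq\Phi(\zeta)\preceq c_{\max}I$ for all $|\zeta|=1$. Put $v[k]=\begin{bmatrix}y[k]^\top & z[k]^\top\end{bmatrix}^\top$. Then there are optimal one-step predictors $$\hat w[k]=\sum_{i=1}^\infty H_i\,w[k-i],\qquad \hat v[k]=\sum_{i=1}^\infty J_i\,v[k-i]$$ with constant matrices $H_i$, $J_i$ (series converging in mean square), where optimal means minimizing the mean-squared error $\mathbb E\|w[k]-\hat w[k]\|_2^2$, respectively $\mathbb E\|v[k]-\hat v[k]\|_2^2$, among the linear predictions from the past $w[k-1],w[k-2],\dots$, respectively $v[k-1],v[k-2],\dots$. For any such predictors the error covariances $$\Sigma=\mathbb E\big[(w[k]-\hat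 w[k])(w[k]-\hat w[k])^\top\big],\qquad \Gamma=\mathbb E\big[(v[k]-\hat v[k])(v[k]-\hat v[k])^\top\big]$$ do not depend on $k$, and their diagonal blocks $\Sigma_{yy}$, $\Gamma_{yy}$ belonging to $y$ have positive determinants. Write $a[0:i]=(a[0],\dots,a[i-1])$ and, for random vectors with a joint Lebesgue density, $I(X;Y\mid Z)=\mathbb E\left[\log\frac{p_{Y|XZ}(Y\mid X,Z)}{p_{Y|Z}(Y\mid Z)}\right]$. Then for every $i\ge1$ the vectors $x[0:i],y[i],y[0:i],z[0:i]$ have a joint density, the conditional mutual information $I(x[0:i];y[i]\mid y[0:i],z[0:i])$ is well defined and finite, and the causally conditioned directed information rate exists and equals $$I^\infty(x\to y\,\|\,z):=\lim_{k\to\infty}\frac1k\sum_{i=1}^{k-1}I\big(x[0:i];y[i]\mid y[0:i],z[0:i]\big)=\frac12\log\frac{\det\Gamma_{yy}}{\det\Sigma_{yy}}.$$ -/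

import Mathlib

open MeasureTheory ProbabilityTheory Filter Topology Matrix Polynomial
open scoped ENNReal ComplexOrder

noncomputable section

namespace DirInfo

/-! ### Vector processes indexed by the integers -/

section Basics

variable {Ω ι κ : Type*} [MeasurableSpace Ω]

/-- Vertical stacking `[a; b]` of two vector-valued processes. -/
def stack (a : ℤ → Ω → ι → ℝ) (b : ℤ → Ω → κ → ℝ) : ℤ → Ω → (ι ⊕ κ) → ℝ :=
  fun k ω => Sum.elim (a k ω) (b k ω)

/-- The segment `a[0:i] = (a[0], …, a[i-1])`. -/
def segment (a : ℤ → Ω → ι → ℝ) (i : ℕ) : Ω → Fin i → ι → ℝ :=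
  fun ω j => a (j : ℕ) ω

/-- (Strict) stationarity: the law of the whole trajectory is invariant under time shifts. -/
def IsStationary (μ : Measure Ω) (w : ℤ → Ω → ι → ℝ) : Prop :=
  ∀ h : ℤ, IdentDistrib (fun ω t => w (t + h) ω) (fun ω t => w t ω) μ μ

/-- The autocovariance sequence `R[k] = E[w[i+k] w[i]ᵀ]` of a stationary zero-mean process
(taken at `i = 0`; by stationarity the choice of `i` is immaterial). -/
def autocov (μ : Measure Ω) (w : ℤ → Ω → ι → ℝ) (k : ℤ) : Matrix ι ι ℝ :=
  Matrix.of fun a b => ∫ ω, w k ω a * w 0 ω b ∂μ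

/-- The terms `ζ^(-k) R[k]` of the Laurent series of the power spectral density. -/
def psdTerm (μ : Measure Ω) (w : ℤ → Ω → ι → ℝ) (ζ : ℂ) (k : ℤ) : Matrix ι ι ℂ :=
  ζ ^ (-k) • (autocov μ w k).map Complex.ofReal

/-- The power spectral density `Φ(ζ) = ∑_{k ∈ ℤ} ζ^(-k) R[k]`. -/
def psd (μ : Measure Ω) (w : ℤ → Ω → ι → ℝ) (ζ : ℂ) : Matrix ι ι ℂ :=
  ∑' k : ℤ, psdTerm μ w ζ k

/-- The power spectral density exists on the unit circle and
`cmin I ≼ Φ(ζ) ≼ cmax I` for all `ζ` on the unit circle. -/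
structure PSDBounds [DecidableEq ι] (μ : Measure Ω) (w : ℤ → Ω → ι → ℝ)
    (cmin cmax : ℝ) : Prop where
  summable : ∀ ζ : ℂ, ‖ζ‖ = 1 → Summable (psdTerm μ w ζ)
  lower : ∀ ζ : ℂ, ‖ζ‖ = 1 →
    (psd μ w ζ - (cmin : ℂ) • (1 : Matrix ι ι ℂ)).PosSemidef
  upper : ∀ ζ : ℂ, ‖ζ‖ = 1 →
    ((cmax : ℂ) • (1 : Matrix ι ι ℂ) - psd μ w ζ).PosSemidef

/-- The power spectral density is rational: on the unit circle every entry is a quotient of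
two polynomials (without poles there, the spectral density being finite on the circle). -/
def RationalPSD (μ : Measure Ω) (w : ℤ → Ω → ι → ℝ) : Prop :=
  ∀ a b : ι, ∃ P Q : ℂ[X], ∀ ζ : ℂ, ‖ζ‖ = 1 →
    Q.eval ζ ≠ 0 ∧ psd μ w ζ a b = P.eval ζ / Q.eval ζ

end Basics

/-! ### One-step optimal linear prediction from the infinite past -/

section Prediction

variable {Ω ι : Type*} [MeasurableSpace Ω] [Fintype ι]

/-- The prediction of `w[k]` by the strictly causal filter `H` truncated after `n` steps:
`∑_{i=1}^{n} H_i w[k-i]`. -/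
def partialPrediction (w : ℤ → Ω → ι → ℝ) (H : ℕ → Matrix ι ι ℝ) (n : ℕ) (k : ℤ) :
    Ω → ι → ℝ :=
  fun ω => ∑ i ∈ Finset.Icc 1 n, H i *ᵥ w (k - (i : ℤ)) ω

/-- The mean-squared error `E‖a - b‖²`, with the Euclidean norm. -/
def mse (μ : Measure Ω) (a b : Ω → ι → ℝ) : ℝ :=
  ∫ ω, (a ω - b ω) ⬝ᵥ (a ω - b ω) ∂μ

/-- `what[k] = ∑_{i=1}^{∞} H_i w[k-i]` (mean-square convergence) for all `k`, and `what[k]` has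
minimal mean-squared error among the linear predictions of `w[k]` from `w[k-1], w[k-2], …`. -/
structure IsOptimalPredictor (μ : Measure Ω) (w : ℤ → Ω → ι → ℝ)
    (H : ℕ → Matrix ι ι ℝ) (what : ℤ → Ω → ι → ℝ) : Prop where
  memLp : ∀ k, MemLp (what k) 2 μ
  tendsto : ∀ k, Tendsto (fun n => eLpNorm (what k - partialPrediction w H n k) 2 μ)
    atTop (𝓝 0)
  optimal : ∀ (k : ℤ) (n : ℕ) (Θ : ℕ → Matrix ι ι ℝ),
    mse μ (w k) (what k) ≤ mse μ (w k) (partialPrediction w Θ n k)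

/-- The prediction error covariance `E[(w[k] - what[k]) (w[k] - what[k])ᵀ]`. -/
def errorCov (μ : Measure Ω) (w what : ℤ → Ω → ι → ℝ) (k : ℤ) : Matrix ι ι ℝ :=
  Matrix.of fun a b => ∫ ω, (w k ω a - what k ω a) * (w k ω b - what k ω b) ∂μ

end Prediction

/-! ### Conditional mutual information and causally conditioned directed information -/

section Information

variable {Ω E F G : Type*} [MeasurableSpace Ω] [MeasureSpace E] [MeasureSpace F] [MeasureSpace G]

/-- The joint density of `(X, Y)` with respect to the product of the reference (Lebesgue)
measures. -/
def jointDensity (μ : Measure Ω) (X : Ω → E) (Y : Ω → F) : E × F → ℝ≥0∞ :=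
  (μ.map fun ω => (X ω, Y ω)).rnDeriv volume

/-- The conditional density `p_{Y|X}(y|x) = p_{XY}(x,y) / ∫ p_{XY}(x,y') dy'`. -/
def condDensity (μ : Measure Ω) (Y : Ω → F) (X : Ω → E) (y : F) (x : E) : ℝ :=
  (jointDensity μ X Y (x, y) / ∫⁻ y', jointDensity μ X Y (x, y')).toReal

/-- The random variable `log (p_{Y|XZ}(Y|X,Z) / p_{Y|Z}(Y|Z))`. -/
def condInfoDensity (μ : Measure Ω) (X : Ω → E) (Y : Ω → F) (Z : Ω → G) (ω : Ω) : ℝ :=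
  Real.log (condDensity μ Y (fun ω' => (X ω', Z ω')) (Y ω) (X ω, Z ω) /
    condDensity μ Y Z (Y ω) (Z ω))

/-- The conditional mutual information
`I(X;Y|Z) = E[log (p_{Y|XZ}(Y|X,Z) / p_{Y|Z}(Y|Z))]`. -/
def condMutualInfo (μ : Measure Ω) (X : Ω → E) (Y : Ω → F) (Z : Ω → G) : ℝ :=
  ∫ ω, condInfoDensity μ X Y Z ω ∂μ

/-- The formula for `I(X;Y|Z)` is meaningful: `(X,Y,Z)` has a joint density and the expectation
exists and is finite. -/
def CondMutualInfoDefined (μ : Measure Ω) (X : Ω → E) (Y : Ω → F) (Z : Ω → G) : Prop :=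
  (μ.map fun ω => (X ω, Y ω, Z ω)) ≪ volume ∧ Integrable (condInfoDensity μ X Y Z) μ

variable {ι κ l : Type*} [Fintype ι] [Fintype κ] [Fintype l]

/-- `I(x[0:i]; y[i] | y[0:i], z[0:i])`. -/
def dirInfoTerm (μ : Measure Ω) (x : ℤ → Ω → ι → ℝ) (y : ℤ → Ω → κ → ℝ)
    (z : ℤ → Ω → l → ℝ) (i : ℕ) : ℝ :=
  condMutualInfo μ (segment x i) (y i) (fun ω => (segment y i ω, segment z i ω))

/-- The term `I(x[0:i]; y[i] | y[0:i], z[0:i])` is well defined. -/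
def DirInfoTermDefined (μ : Measure Ω) (x : ℤ → Ω → ι → ℝ) (y : ℤ → Ω → κ → ℝ)
    (z : ℤ → Ω → l → ℝ) (i : ℕ) : Prop :=
  CondMutualInfoDefined μ (segment x i) (y i) (fun ω => (segment y i ω, segment z i ω))

/-- Causally conditioned directed information
`I(x[0:k] → y[0:k] ‖ z[0:k]) = ∑_{i=1}^{k-1} I(x[0:i]; y[i] | y[0:i], z[0:i])`. -/
def causalDirInfo (μ : Measure Ω) (x : ℤ → Ω → ι → ℝ) (y : ℤ → Ω → κ → ℝ)
    (z : ℤ → Ω → l → ℝ) (k : ℕ) : ℝ :=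
  ∑ i ∈ Finset.Ico 1 k, dirInfoTerm μ x y z i

/-- The causally conditioned directed information rate of `x` to `y` given `z` exists and equals
`I`: every term is well defined and `(1/k) I(x[0:k] → y[0:k] ‖ z[0:k]) → I`. -/
def HasDirInfoRate (μ : Measure Ω) (x : ℤ → Ω → ι → ℝ) (y : ℤ → Ω → κ → ℝ)
    (z : ℤ → Ω → l → ℝ) (I : ℝ) : Prop :=
  (∀ i : ℕ, 1 ≤ i → DirInfoTermDefined μ x y z i) ∧
    Tendsto (fun k : ℕ => (1 / (k : ℝ)) * causalDirInfo μ x y z k) atTop (𝓝 I)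

end Information

end DirInfo

end

/-!
The spectral bounds `cmin I ≼ Φ ≼ cmax I` say that the covariance form of the process lies between
`cmin` and `cmax` times the sum of squared coefficients (`isStationaryRiesz_coordLp`): the form is
the integral over the unit circle of `Φ` against trigonometric polynomials
(`toeplitz_form_nonneg`). Hence the components of `w`, and of its part `v`, form in `L²` a family
on which coefficients and vectors control each other, uniformly in the number of terms.

Two facts about prediction follow by Hilbert space geometry. The projections of `w[k]` onto the
finite pasts `w[k-1], …, w[k-n]` converge to the projection onto the closed infinite past, and so do
their coefficients, which by stationarity do not depend on `k`
(`IsStationaryRiesz.exists_tendsto_filterSum`); this gives a convergent optimal predictor.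
Conversely every optimal predictor is that projection, so its error covariance is the limit of the
error covariances of the predictors from finite pasts, and is bounded below by `cmin I`
(`IsOptimalPredictor.exists_errorCov`). Rationality of `Φ` plays no role in this argument.

For the information rate, write `y[i]` as its prediction from the finite past plus an error. The
error is uncorrelated with that past, hence independent of it, the process being Gaussian. So the
conditional density of `y[i]` given the past is the Gaussian density of the error, evaluated at the
error (`condDensity_of_indep`, `exists_log_condDensity`), and its expected logarithm is
`-(1/2) log det` of the error covariance plus a constant depending only on the dimension of `y`
(`exists_gaussian_density`). Applied to the past of `w` and to the past of `v`, this shows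
`I(x[0:i]; y[i] | y[0:i], z[0:i]) = (1/2) log (det Γᵢ / det Σᵢ)`, where `Σᵢ` and `Γᵢ` are the
covariances of the errors in predicting `y[i]` from the last `i` values of `w` and of `v`. As
`Σᵢ → Σ_yy` and `Γᵢ → Γ_yy`, the averages of these terms converge to the asserted value.
-/

noncomputable section

namespace DirInfo

/-! ### Linear prediction of stationary families in a Hilbert space -/

section HilbertPrediction

open scoped InnerProductSpace

variable {H σ : Type*} [NormedAddCommGroup H] [InnerProductSpace ℝ H] [Fintype σ]

/-- A family `U k a` (time `k`, component `a`) of Hilbert space vectors whose Gram matrix is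
invariant under time shifts and whose finite linear combinations have squared norm between `cmin`
and `cmax` times the sum of the squared coefficients. For the components of a stationary process
in `L²` these are the bounds `cmin I ≼ Φ ≼ cmax I` on the spectral density. -/
structure IsStationaryRiesz (U : ℤ → σ → H) (cmin cmax : ℝ) : Prop where
  cmin_pos : 0 < cmin
  inner_shift : ∀ h k j a b, ⟪U (k + h) a, U (j + h) b⟫_ℝ = ⟪U k a, U j b⟫_ℝ
  lower : ∀ (s : Finset ℤ) (c : ℤ → σ → ℝ),
    cmin * ∑ k ∈ s, ∑ a, c k a ^ 2 ≤ ‖∑ k ∈ s, ∑ a, c k a • U k a‖ ^ 2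
  upper : ∀ (s : Finset ℤ) (c : ℤ → σ → ℝ),
    ‖∑ k ∈ s, ∑ a, c k a • U k a‖ ^ 2 ≤ cmax * ∑ k ∈ s, ∑ a, c k a ^ 2

/-- The component `a` of the output at time `k` of the filter `Θ` truncated after `n` steps,
`∑_{i=1}^{n} Θ_i U[k-i]`: the Hilbert space version of `partialPrediction`. -/
def filterSum (U : ℤ → σ → H) (Θ : ℕ → Matrix σ σ ℝ) (n : ℕ) (k : ℤ) (a : σ) : H :=
  ∑ i ∈ Finset.Icc 1 n, ∑ b, Θ i a b • U (k - (i : ℤ)) b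

/-- The span of the `n` steps `U[k-1], …, U[k-n]` before time `k`. -/
def past (U : ℤ → σ → H) (n : ℕ) (k : ℤ) : Submodule ℝ H :=
  Submodule.span ℝ (Set.range fun p : Fin n × σ => U (k - ((p.1 : ℕ) + 1 : ℕ)) p.2)

/-- The closed span of everything strictly before time `k`. -/
def infinitePast (U : ℤ → σ → H) (k : ℤ) : Submodule ℝ H :=
  (⨆ n, past U n k).topologicalClosure

instance (U : ℤ → σ → H) (n : ℕ) (k : ℤ) : FiniteDimensional ℝ (past U n k) :=
  FiniteDimensional.span_of_finite ℝ (Set.finite_range _)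

instance [CompleteSpace H] (U : ℤ → σ → H) (k : ℤ) : CompleteSpace (infinitePast U k) :=
  (Submodule.isClosed_topologicalClosure _).completeSpace_coe

variable {U : ℤ → σ → H} {cmin cmax : ℝ}

/-- Selecting components preserves the bounds: the coefficients of the others are set to zero. -/
lemma IsStationaryRiesz.restrict {τ : Type*} [Fintype τ] (hU : IsStationaryRiesz U cmin cmax)
    {e : τ → σ} (he : Function.Injective e) :
    IsStationaryRiesz (fun k b => U k (e b)) cmin cmax := by
  classical
  have h1 (c : ℤ → τ → ℝ) (k : ℤ) :
      ∑ a, Function.extend e (c k) 0 a ^ 2 = ∑ b, c k b ^ 2 := by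
    rw [← Finset.sum_subset (Finset.subset_univ (Finset.univ.image e)),
      Finset.sum_image he.injOn]
    · simp [he.extend_apply]
    · intro a _ ha
      rw [Function.extend_apply' _ _ _ (by simpa using ha)]; simp
  have h2 (c : ℤ → τ → ℝ) (k : ℤ) :
      ∑ a, Function.extend e (c k) 0 a • U k a = ∑ b, c k b • U k (e b) := by
    rw [← Finset.sum_subset (Finset.subset_univ (Finset.univ.image e)),
      Finset.sum_image he.injOn]
    · simp [he.extend_apply]
    · intro a _ ha
      rw [Function.extend_apply' _ _ _ (by simpa using ha)]; simp
  refine ⟨hU.cmin_pos, fun h k j a b => hU.inner_shift h k j _ _, fun s c => ?_, fun s c => ?_⟩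
  · simpa only [h1, h2] using hU.lower s fun k => Function.extend e (c k) 0
  · simpa only [h1, h2] using hU.upper s fun k => Function.extend e (c k) 0

omit [Fintype σ] in
lemma mem_past {n i : ℕ} (h1 : 1 ≤ i) (hn : i ≤ n) (k : ℤ) (b : σ) :
    U (k - (i : ℤ)) b ∈ past U n k := by
  refine Submodule.subset_span ⟨(⟨i - 1, by omega⟩, b), ?_⟩
  have : i - 1 + 1 = i := by omega
  simp only [this]

omit [Fintype σ] in
lemma past_mono (k : ℤ) : Monotone fun n => past U n k := by
  intro m n hmn
  refine Submodule.span_le.2 ?_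
  rintro _ ⟨p, rfl⟩
  exact mem_past (by omega) (by have := p.1.2; omega) k p.2

lemma filterSum_mem_past (Θ : ℕ → Matrix σ σ ℝ) (n : ℕ) (k : ℤ) (a : σ) :
    filterSum U Θ n k a ∈ past U n k := by
  refine Submodule.sum_mem _ fun i hi => Submodule.sum_mem _ fun b _ => Submodule.smul_mem _ _ ?_
  rw [Finset.mem_Icc] at hi
  exact mem_past hi.1 hi.2 k b

lemma filterSum_mem_infinitePast (Θ : ℕ → Matrix σ σ ℝ) (n : ℕ) (k : ℤ) (a : σ) :
    filterSum U Θ n k a ∈ infinitePast U k :=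
  Submodule.le_topologicalClosure _ (le_iSup (fun n => past U n k) n (filterSum_mem_past Θ n k a))

lemma filterSum_eq_of_le {Θ : ℕ → Matrix σ σ ℝ} {n N : ℕ} (hΘ : ∀ i, n < i → Θ i = 0)
    (h : n ≤ N) (k : ℤ) (a : σ) : filterSum U Θ N k a = filterSum U Θ n k a := by
  symm
  refine Finset.sum_subset (Finset.Icc_subset_Icc_right h) fun i hi hi' => ?_
  have : n < i := by simp only [Finset.mem_Icc] at hi hi'; omega
  simp [hΘ i this]

lemma filterSum_sub (Θ Ξ : ℕ → Matrix σ σ ℝ) (n : ℕ) (k : ℤ) (a : σ) :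
    filterSum U (Θ - Ξ) n k a = filterSum U Θ n k a - filterSum U Ξ n k a := by
  simp [filterSum, sub_smul, Finset.sum_sub_distrib]

/-- A combination of `U[k-i]`, indexed by delays `i`, as a combination indexed by times. -/
lemma past_sum_eq (s : Finset ℕ) (c : ℕ → σ → ℝ) (k : ℤ) :
    ∃ (t : Finset ℤ) (d : ℤ → σ → ℝ),
      ∑ i ∈ s, ∑ b, c i b ^ 2 = ∑ m ∈ t, ∑ b, d m b ^ 2 ∧
      ∑ i ∈ s, ∑ b, c i b • U (k - (i : ℤ)) b = ∑ m ∈ t, ∑ b, d m b • U m b := by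
  have hinj : Set.InjOn (fun i : ℕ => k - (i : ℤ)) (s : Set ℕ) := fun i _ j _ h => by
    simpa using h
  refine ⟨s.image fun i : ℕ => k - (i : ℤ), fun m => c (k - m).toNat, ?_, ?_⟩
  · rw [Finset.sum_image hinj]; simp
  · rw [Finset.sum_image hinj]; simp

lemma IsStationaryRiesz.lower_past (hU : IsStationaryRiesz U cmin cmax) (s : Finset ℕ)
    (c : ℕ → σ → ℝ) (k : ℤ) :
    cmin * ∑ i ∈ s, ∑ b, c i b ^ 2 ≤ ‖∑ i ∈ s, ∑ b, c i b • U (k - (i : ℤ)) b‖ ^ 2 := by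
  obtain ⟨t, d, h1, h2⟩ := past_sum_eq (U := U) s c k
  rw [h1, h2]; exact hU.lower t d

lemma IsStationaryRiesz.upper_past (hU : IsStationaryRiesz U cmin cmax) (s : Finset ℕ)
    (c : ℕ → σ → ℝ) (k : ℤ) :
    ‖∑ i ∈ s, ∑ b, c i b • U (k - (i : ℤ)) b‖ ^ 2 ≤ cmax * ∑ i ∈ s, ∑ b, c i b ^ 2 := by
  obtain ⟨t, d, h1, h2⟩ := past_sum_eq (U := U) s c k
  rw [h1, h2]; exact hU.upper t d

lemma IsStationaryRiesz.inner_eq (hU : IsStationaryRiesz U cmin cmax) (k l : ℤ) (i j : ℤ)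
    (a b : σ) : ⟪U (k - i) a, U (k - j) b⟫_ℝ = ⟪U (l - i) a, U (l - j) b⟫_ℝ := by
  have := hU.inner_shift (k - l) (l - i) (l - j) a b
  rw [← this]; congr 2 <;> ring

lemma IsStationaryRiesz.inner_residual_left (hU : IsStationaryRiesz U cmin cmax)
    (Θ : ℕ → Matrix σ σ ℝ) (n : ℕ) (k l : ℤ) (a b : σ) (j : ℤ) :
    ⟪U k a - filterSum U Θ n k a, U (k - j) b⟫_ℝ =
      ⟪U l a - filterSum U Θ n l a, U (l - j) b⟫_ℝ := by
  have h0 := hU.inner_eq k l 0 j a b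
  simp only [sub_zero] at h0
  simp only [inner_sub_left, filterSum, sum_inner, inner_smul_left, h0, hU.inner_eq k l]

lemma IsStationaryRiesz.inner_residual (hU : IsStationaryRiesz U cmin cmax)
    (Θ : ℕ → Matrix σ σ ℝ) (n : ℕ) (k l : ℤ) (a b : σ) :
    ⟪U k a - filterSum U Θ n k a, U k b - filterSum U Θ n k b⟫_ℝ =
      ⟪U l a - filterSum U Θ n l a, U l b - filterSum U Θ n l b⟫_ℝ := by
  have h0 := hU.inner_residual_left Θ n k l a b 0
  simp only [sub_zero] at h0
  rw [inner_sub_right, inner_sub_right, h0]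
  congr 1
  simp only [filterSum, inner_sum, inner_smul_right]
  exact Finset.sum_congr rfl fun i _ => Finset.sum_congr rfl fun c _ => by
    congr 1; exact hU.inner_residual_left Θ n k l a c i

lemma exists_filter_eq_starProjection_zero (U : ℤ → σ → H) (n : ℕ) :
    ∃ Θ : ℕ → Matrix σ σ ℝ, (∀ i, n < i → Θ i = 0) ∧
      ∀ a, filterSum U Θ n 0 a = (past U n 0).starProjection (U 0 a) := by
  have h (a : σ) : ∃ c : Fin n × σ → ℝ, ∑ p, c p • U (0 - ((p.1 : ℕ) + 1 : ℕ)) p.2 =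
      (past U n 0).starProjection (U 0 a) :=
    (Submodule.mem_span_range_iff_exists_fun ℝ).1
      (Submodule.starProjection_apply_mem (past U n 0) (U 0 a))
  choose c hc using h
  refine ⟨fun i => Matrix.of fun a b =>
    if h : 1 ≤ i ∧ i ≤ n then c a (⟨i - 1, by omega⟩, b) else 0, ?_, fun a => ?_⟩
  · intro i hi; ext a b
    exact dif_neg (by omega)
  · rw [← hc a, Fintype.sum_prod_type, filterSum, ← Finset.Ico_add_one_right_eq_Icc,
      Finset.sum_Ico_eq_sum_range, Nat.add_sub_cancel, Finset.sum_range]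
    refine Finset.sum_congr rfl fun i _ => Finset.sum_congr rfl fun b _ => ?_
    have hi : 1 ≤ 1 + (i : ℕ) ∧ 1 + (i : ℕ) ≤ n := by have := i.2; omega
    have h1 : (if h : 1 ≤ 1 + (i : ℕ) ∧ 1 + (i : ℕ) ≤ n then
        c a (⟨1 + (i : ℕ) - 1, by omega⟩, b) else 0) = c a (i, b) := by
      rw [dif_pos hi]; simp only [add_tsub_cancel_left]
    rw [← h1, add_comm (i : ℕ) 1]
    rfl

/-- The coefficients of the projection onto the finite past do not depend on the time. -/
lemma IsStationaryRiesz.exists_filter_eq_starProjection (hU : IsStationaryRiesz U cmin cmax)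
    (n : ℕ) : ∃ Θ : ℕ → Matrix σ σ ℝ, (∀ i, n < i → Θ i = 0) ∧
      ∀ k a, filterSum U Θ n k a = (past U n k).starProjection (U k a) := by
  obtain ⟨Θ, h0, hΘ⟩ := exists_filter_eq_starProjection_zero U n
  refine ⟨Θ, h0, fun k a => ?_⟩
  refine (Submodule.eq_starProjection_of_mem_of_inner_eq_zero (filterSum_mem_past Θ n k a)
    fun x hx => ?_).symm
  refine Submodule.span_induction ?_ (by simp) (fun x y _ _ hx hy => by
    rw [inner_add_right, hx, hy, add_zero]) (fun c x _ hx => by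
    rw [inner_smul_right, hx, mul_zero]) hx
  rintro _ ⟨p, rfl⟩
  rw [hU.inner_residual_left Θ n k 0, hΘ]
  exact Submodule.starProjection_inner_eq_zero _ _
    (mem_past (by omega) (by have := p.1.2; omega) 0 p.2)

lemma tendsto_starProjection_past [CompleteSpace H] (U : ℤ → σ → H) (k : ℤ) (x : H) :
    Tendsto (fun n => (past U n k).starProjection x) atTop
      (𝓝 ((infinitePast U k).starProjection x)) :=
  Submodule.starProjection_tendsto_closure_iSup (fun n => past U n k) (past_mono k) x

/-- A uniformly positive definite stationary family has a convergent predictor: the coefficients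
of the projections onto the finite pasts converge, and the series formed with the limits
converges to the projection onto the infinite past. -/
lemma IsStationaryRiesz.exists_tendsto_filterSum [CompleteSpace H]
    (hU : IsStationaryRiesz U cmin cmax) :
    ∃ Θ : ℕ → Matrix σ σ ℝ, ∀ k a, Tendsto (fun n => filterSum U Θ n k a) atTop
      (𝓝 ((infinitePast U k).starProjection (U k a))) := by
  choose Θ hΘ0 hΘ using hU.exists_filter_eq_starProjection
  have hlim (k : ℤ) (a : σ) : Tendsto (fun n => filterSum U (Θ n) n k a) atTop
      (𝓝 ((infinitePast U k).starProjection (U k a))) := by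
    simp only [hΘ]; exact tendsto_starProjection_past U k _
  have hcmin := hU.cmin_pos
  have hdiff (k : ℤ) (a : σ) (m n N : ℕ) :
      cmin * ∑ i ∈ Finset.Icc 1 N, ∑ b, (Θ m i a b - Θ n i a b) ^ 2 ≤
        ‖filterSum U (Θ m) m k a - filterSum U (Θ n) n k a‖ ^ 2 := by
    set M := max N (max m n)
    calc _ ≤ cmin * ∑ i ∈ Finset.Icc 1 M, ∑ b, (Θ m i a b - Θ n i a b) ^ 2 := by
          refine mul_le_mul_of_nonneg_left ?_ hcmin.le
          exact Finset.sum_le_sum_of_subset_of_nonneg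
            (Finset.Icc_subset_Icc_right (le_max_left _ _))
            fun _ _ _ => Finset.sum_nonneg fun _ _ => sq_nonneg _
      _ ≤ _ := by
          rw [← filterSum_eq_of_le (hΘ0 m) (show m ≤ M by simp [M]),
            ← filterSum_eq_of_le (hΘ0 n) (show n ≤ M by simp [M]), ← filterSum_sub]
          exact hU.lower_past (Finset.Icc 1 M) (fun i b => Θ m i a b - Θ n i a b) k
  have hcoef (i : ℕ) (a b : σ) : ∃ l, 1 ≤ i → Tendsto (fun n => Θ n i a b) atTop (𝓝 l) := by
    -- The entry `i = 0` never enters a strictly causal filter.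
    by_cases hi : 1 ≤ i
    swap
    · exact ⟨0, fun h => absurd h hi⟩
    suffices h : ∃ l, Tendsto (fun n => Θ n i a b) atTop (𝓝 l) from h.imp fun _ h _ => h
    refine cauchySeq_tendsto_of_complete ?_
    have hc := (hlim 0 a).cauchySeq
    rw [Metric.cauchySeq_iff] at hc ⊢
    intro ε hε
    obtain ⟨N, hN⟩ := hc (√cmin * ε) (by positivity)
    refine ⟨N, fun m hm n hn => ?_⟩
    have h1 := hN m hm n hn
    rw [dist_eq_norm] at h1
    have h2 := hdiff 0 a m n i
    have h3 : (Θ m i a b - Θ n i a b) ^ 2 ≤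
        ∑ j ∈ Finset.Icc 1 i, ∑ b, (Θ m j a b - Θ n j a b) ^ 2 :=
      (Finset.single_le_sum (f := fun b => (Θ m i a b - Θ n i a b) ^ 2)
        (fun _ _ => sq_nonneg _) (Finset.mem_univ b)).trans
      (Finset.single_le_sum (f := fun j => ∑ b, (Θ m j a b - Θ n j a b) ^ 2)
        (fun _ _ => Finset.sum_nonneg fun _ _ => sq_nonneg _) (by simp; omega))
    rw [Real.dist_eq]
    refine abs_lt_of_sq_lt_sq ?_ hε.le
    have h4 := mul_le_mul_of_nonneg_left h3 hcmin.le
    have h5 : ‖filterSum U (Θ m) m 0 a - filterSum U (Θ n) n 0 a‖ ^ 2 < (√cmin * ε) ^ 2 :=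
      pow_lt_pow_left₀ h1 (norm_nonneg _) two_ne_zero
    rw [mul_pow, Real.sq_sqrt hcmin.le] at h5
    exact lt_of_mul_lt_mul_left ((h4.trans h2).trans_lt h5) hcmin.le
  -- The bounds turn closeness of the projections into closeness of their coefficients and back.
  choose L hL using hcoef
  refine ⟨fun i => Matrix.of (L i), fun k a => ?_⟩
  set P := (infinitePast U k).starProjection (U k a)
  have hLn (n N : ℕ) : cmin * ∑ i ∈ Finset.Icc 1 N, ∑ b, (L i a b - Θ n i a b) ^ 2 ≤
      ‖P - filterSum U (Θ n) n k a‖ ^ 2 := by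
    have h1 : Tendsto (fun m => cmin * ∑ i ∈ Finset.Icc 1 N, ∑ b, (Θ m i a b - Θ n i a b) ^ 2)
        atTop (𝓝 (cmin * ∑ i ∈ Finset.Icc 1 N, ∑ b, (L i a b - Θ n i a b) ^ 2)) :=
      (tendsto_finsetSum _ fun i hi => tendsto_finsetSum _ fun b _ =>
        ((hL i a b (Finset.mem_Icc.1 hi).1).sub_const _).pow 2).const_mul _
    exact le_of_tendsto_of_tendsto' h1 ((hlim k a).sub_const _ |>.norm.pow 2)
      fun m => hdiff k a m n N
  -- `cmax` may be negative only if `σ` is empty; `max cmax 0` avoids the case distinction.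
  have hcmax : 0 ≤ max cmax 0 := le_max_right _ _
  have hN (n N : ℕ) (h : n ≤ N) : ‖filterSum U (fun i => Matrix.of (L i)) N k a - P‖ ≤
      (√(max cmax 0 / cmin) + 1) * ‖filterSum U (Θ n) n k a - P‖ := by
    have h1 : ‖filterSum U (fun i => Matrix.of (L i)) N k a - filterSum U (Θ n) n k a‖ ≤
        √(max cmax 0 / cmin) * ‖filterSum U (Θ n) n k a - P‖ := by
      refine abs_le_of_sq_le_sq' ?_ (by positivity) |>.2
      rw [mul_pow, Real.sq_sqrt (by positivity), norm_sub_rev _ P,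
        ← filterSum_eq_of_le (hΘ0 n) h, ← filterSum_sub]
      have hS : 0 ≤ ∑ i ∈ Finset.Icc 1 N, ∑ b, (L i a b - Θ n i a b) ^ 2 :=
        Finset.sum_nonneg fun _ _ => Finset.sum_nonneg fun _ _ => sq_nonneg _
      have h2 := hU.upper_past (Finset.Icc 1 N) (fun i b => L i a b - Θ n i a b) k
      have h3 := hLn n N
      rw [← filterSum_eq_of_le (hΘ0 n) h] at h3
      refine (h2.trans (mul_le_mul_of_nonneg_right (le_max_left cmax 0) hS)).trans ?_
      rw [div_mul_eq_mul_div, le_div_iff₀ hcmin, mul_assoc]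
      refine mul_le_mul_of_nonneg_left ?_ hcmax
      rw [mul_comm]; exact h3
    calc _ ≤ _ + _ := norm_sub_le_norm_sub_add_norm_sub _ (filterSum U (Θ n) n k a) _
      _ ≤ _ := by rw [add_mul, one_mul]; gcongr
  rw [tendsto_iff_norm_sub_tendsto_zero]
  refine squeeze_zero (fun _ => norm_nonneg _) (fun n => hN n n le_rfl) ?_
  simpa using (tendsto_iff_norm_sub_tendsto_zero.1 (hlim k a)).const_mul _

/-- Minimality over all finite filters forces a mean-square limit of filter outputs to be the
projection onto the infinite past, by Pythagoras' theorem. -/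
lemma IsStationaryRiesz.eq_starProjection_of_optimal [CompleteSpace H]
    (hU : IsStationaryRiesz U cmin cmax) {k : ℤ} {W : σ → H} {Θ : ℕ → Matrix σ σ ℝ}
    (hW : ∀ a, Tendsto (fun n => filterSum U Θ n k a) atTop (𝓝 (W a)))
    (hopt : ∀ (n : ℕ) (Ξ : ℕ → Matrix σ σ ℝ),
      ∑ a, ‖U k a - W a‖ ^ 2 ≤ ∑ a, ‖U k a - filterSum U Ξ n k a‖ ^ 2) (a : σ) :
    W a = (infinitePast U k).starProjection (U k a) := by
  choose Ξ hΞ0 hΞ using hU.exists_filter_eq_starProjection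
  have hmem (a : σ) : W a ∈ infinitePast U k :=
    (Submodule.isClosed_topologicalClosure _).mem_of_tendsto (hW a)
      (.of_forall fun n => filterSum_mem_infinitePast Θ n k a)
  have hle : ∑ a, ‖U k a - W a‖ ^ 2 ≤
      ∑ a, ‖U k a - (infinitePast U k).starProjection (U k a)‖ ^ 2 := by
    refine ge_of_tendsto' (tendsto_finsetSum _ fun a _ =>
      ((tendsto_starProjection_past U k (U k a)).const_sub (U k a)).norm.pow 2) fun n => ?_
    simpa only [hΞ] using hopt n (Ξ n)
  have hpyth (a : σ) : ‖U k a - W a‖ ^ 2 =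
      ‖U k a - (infinitePast U k).starProjection (U k a)‖ ^ 2 +
        ‖(infinitePast U k).starProjection (U k a) - W a‖ ^ 2 := by
    have h0 := Submodule.starProjection_inner_eq_zero (K := infinitePast U k) (U k a)
      ((infinitePast U k).starProjection (U k a) - W a)
      (Submodule.sub_mem _ (Submodule.starProjection_apply_mem _ _) (hmem a))
    have := norm_add_sq_eq_norm_sq_add_norm_sq_of_inner_eq_zero _ _ h0
    rw [sub_add_sub_cancel] at this
    nlinarith [this]
  simp only [hpyth, Finset.sum_add_distrib] at hle
  have h0 : ∑ a, ‖(infinitePast U k).starProjection (U k a) - W a‖ ^ 2 = 0 :=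
    le_antisymm (by linarith) (Finset.sum_nonneg fun _ _ => sq_nonneg _)
  have := (Finset.sum_eq_zero_iff_of_nonneg fun _ _ => sq_nonneg _).1 h0 a (Finset.mem_univ a)
  exact (sub_eq_zero.1 (norm_eq_zero.1 (pow_eq_zero_iff two_ne_zero |>.1 this))).symm

/-- The lower bound survives in every prediction error, since `U[k]` enters with its own
coefficients and the past only adds squares. -/
lemma IsStationaryRiesz.lower_residual (hU : IsStationaryRiesz U cmin cmax)
    (Θ : ℕ → Matrix σ σ ℝ) (n : ℕ) (k : ℤ) (c : σ → ℝ) :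
    cmin * ∑ a, c a ^ 2 ≤ ‖∑ a, c a • (U k a - filterSum U Θ n k a)‖ ^ 2 := by
  have h := hU.lower_past (insert 0 (Finset.Icc 1 n))
    (fun i b => if i = 0 then c b else -∑ a, c a * Θ i a b) k
  rw [Finset.sum_insert (by simp), Finset.sum_insert (by simp)] at h
  simp only [if_true, Nat.cast_zero, sub_zero] at h
  have e : ∑ a, c a • (U k a - filterSum U Θ n k a) = ∑ b, c b • U k b +
      ∑ i ∈ Finset.Icc 1 n, ∑ b, (if i = 0 then c b else -∑ a, c a * Θ i a b) •
        U (k - (i : ℤ)) b := by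
    simp only [smul_sub, Finset.sum_sub_distrib]
    rw [sub_eq_add_neg, ← Finset.sum_neg_distrib]
    congr 1
    simp only [filterSum, Finset.smul_sum, ← Finset.sum_neg_distrib]
    rw [Finset.sum_comm]
    refine Finset.sum_congr rfl fun i hi => ?_
    have : i ≠ 0 := by simp only [Finset.mem_Icc] at hi; omega
    rw [Finset.sum_comm]
    refine Finset.sum_congr rfl fun b _ => ?_
    simp only [if_neg this, Finset.sum_smul, smul_smul, neg_smul]
  rw [e]
  refine le_trans (mul_le_mul_of_nonneg_left ?_ hU.cmin_pos.le) h
  exact le_add_of_nonneg_right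
    (Finset.sum_nonneg fun _ _ => Finset.sum_nonneg fun _ _ => sq_nonneg _)

end HilbertPrediction

/-! ### Densities of nondegenerate Gaussian vectors -/

section GaussianDensity

variable {σ : Type*} [Fintype σ]

/-- The Lebesgue density of a vector of independent standard Gaussian variables. -/
def stdGaussianDensity (x : σ → ℝ) : ℝ := ∏ a, gaussianPDFReal 0 1 (x a)

lemma measurable_stdGaussianDensity : Measurable (stdGaussianDensity (σ := σ)) :=
  Finset.measurable_prod _ fun a _ =>
    (measurable_gaussianPDFReal 0 1).comp (measurable_pi_apply a)

lemma stdGaussianDensity_pos (x : σ → ℝ) : 0 < stdGaussianDensity x :=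
  Finset.prod_pos fun _ _ => gaussianPDFReal_pos _ _ _ one_ne_zero

lemma log_stdGaussianDensity (x : σ → ℝ) : Real.log (stdGaussianDensity x) =
    ∑ a, (Real.log (√(2 * Real.pi))⁻¹ - x a ^ 2 / 2) := by
  rw [stdGaussianDensity, Real.log_prod fun a _ => (gaussianPDFReal_pos _ _ _ one_ne_zero).ne']
  refine Finset.sum_congr rfl fun a _ => ?_
  rw [gaussianPDFReal, Real.log_mul (by positivity) (Real.exp_pos _).ne', Real.log_exp]
  simp
  ring

lemma pi_gaussianReal_eq_withDensity :
    Measure.pi (fun _ : σ => gaussianReal 0 1) =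
      volume.withDensity fun x => ENNReal.ofReal (stdGaussianDensity x) := by
  refine Measure.pi_eq fun s hs => ?_
  have hG (a : σ) : Integrable ((s a).indicator (gaussianPDFReal 0 1)) :=
    (integrable_gaussianPDFReal 0 1).indicator (hs a)
  have hG0 (a : σ) (x : ℝ) : 0 ≤ (s a).indicator (gaussianPDFReal 0 1) x :=
    Set.indicator_nonneg (fun _ _ => gaussianPDFReal_nonneg _ _ _) _
  have hind (x : σ → ℝ) : (Set.univ.pi s).indicator
      (fun x => ENNReal.ofReal (stdGaussianDensity x)) x =
      ENNReal.ofReal (∏ a, (s a).indicator (gaussianPDFReal 0 1) (x a)) := by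
    by_cases hx : x ∈ Set.univ.pi s
    · rw [Set.indicator_of_mem hx, stdGaussianDensity]
      congr 1
      exact Finset.prod_congr rfl fun a _ => (Set.indicator_of_mem (hx a (Set.mem_univ a)) _).symm
    · rw [Set.indicator_of_notMem hx]
      obtain ⟨a, ha⟩ : ∃ a, x a ∉ s a := by simpa [Set.mem_pi] using hx
      rw [Finset.prod_eq_zero (Finset.mem_univ a) (Set.indicator_of_notMem ha _),
        ENNReal.ofReal_zero]
  rw [withDensity_apply _ (MeasurableSet.univ_pi hs),
    ← lintegral_indicator (MeasurableSet.univ_pi hs)]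
  simp only [hind]
  rw [volume_pi, ← ofReal_integral_eq_lintegral_ofReal (Integrable.fintype_prod hG)
    (.of_forall fun x => Finset.prod_nonneg fun a _ => hG0 a _),
    integral_fintype_prod_eq_prod (fun a => (s a).indicator (gaussianPDFReal 0 1)),
    ENNReal.ofReal_prod_of_nonneg fun a _ => integral_nonneg (hG0 a)]
  refine Finset.prod_congr rfl fun a _ => ?_
  rw [integral_indicator (hs a), gaussianReal_apply_eq_integral _ one_ne_zero]

open scoped MatrixOrder Matrix.Norms.L2Operator in
lemma exists_eq_transpose_mul_self {S : Matrix σ σ ℝ} (hS : S.PosSemidef) :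
    ∃ B : Matrix σ σ ℝ, S = Bᵀ * B := by
  classical
  obtain ⟨B, hB⟩ := CStarAlgebra.nonneg_iff_eq_star_mul_self.mp hS.nonneg
  exact ⟨B, by rw [hB, star_eq_conjTranspose, conjTranspose_eq_transpose_of_trivial]⟩

/-- A centred Gaussian vector `N` with invertible covariance matrix `S` has a positive density `f`,
and its negative differential entropy `E log f(N)` depends on `S` only through `log det S`. With
`S = Bᵀ B`, the vector `(Bᵀ)⁻¹ N` is standard, so both facts follow by a linear change of
variables. -/
lemma exists_gaussian_density {Ω : Type*} [MeasurableSpace Ω] {μ : Measure Ω} [DecidableEq σ]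
    {N : Ω → σ → ℝ} (hN : HasGaussianLaw N μ) (hmean : ∀ a, ∫ ω, N ω a ∂μ = 0)
    {S : Matrix σ σ ℝ} (hS : S.PosDef) (hcov : ∀ a b, ∫ ω, N ω a * N ω b ∂μ = S a b) :
    ∃ f : (σ → ℝ) → ℝ≥0∞, Measurable f ∧ μ.map N = volume.withDensity f ∧
      (∀ x, f x ≠ 0 ∧ f x ≠ ∞) ∧ Integrable (fun ω => Real.log (f (N ω)).toReal) μ ∧
      ∫ ω, Real.log (f (N ω)).toReal ∂μ = -(1 / 2) * Real.log S.det +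
        Fintype.card σ * (Real.log (√(2 * Real.pi))⁻¹ - 1 / 2) := by
  have := hN.isProbabilityMeasure
  obtain ⟨B, hB⟩ : ∃ B : Matrix σ σ ℝ, S = Bᵀ * B :=
    exists_eq_transpose_mul_self hS.posSemidef
  have hdet : S.det = B.det ^ 2 := by rw [hB, det_mul, det_transpose, sq]
  have hB0 : B.det ≠ 0 := by
    have := hS.det_pos
    rw [hdet] at this
    exact fun h => by simp [h] at this
  have hBu : IsUnit B.det := isUnit_iff_ne_zero.2 hB0
  -- `M` whitens `N`.
  set M : Matrix σ σ ℝ := (Bᵀ)⁻¹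
  have hM0 : M.det ≠ 0 := by
    simp [M, Matrix.det_nonsing_inv, hB0]
  have hMS : M * S * Mᵀ = 1 := by
    rw [hB, ← Matrix.mul_assoc, Matrix.nonsing_inv_mul _ (by simpa using hBu), Matrix.one_mul,
      Matrix.transpose_nonsing_inv, Matrix.transpose_transpose, Matrix.mul_nonsing_inv _ hBu]
  obtain ⟨Z, hZdef⟩ : ∃ Z : Ω → σ → ℝ, Z = fun ω => M *ᵥ N ω := ⟨_, rfl⟩
  have hZ : HasGaussianLaw Z μ :=
    hZdef ▸ hN.map_fun (LinearMap.toContinuousLinearMap (Matrix.toLin' M))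
  have hNL (a : σ) : MemLp (fun ω => N ω a) 2 μ := (hN.eval a).memLp_two
  have hZL (a : σ) : MemLp (fun ω => Z ω a) 2 μ := (hZ.eval a).memLp_two
  have hZmean (a : σ) : ∫ ω, Z ω a ∂μ = 0 := by
    simp only [hZdef, mulVec, dotProduct]
    rw [integral_finsetSum _ fun b _ => ((hNL b).integrable one_le_two).const_mul _]
    simp [integral_const_mul, hmean]
  have hZcov (a b : σ) : ∫ ω, Z ω a * Z ω b ∂μ = (1 : Matrix σ σ ℝ) a b := by
    rw [← hMS]
    have h1 (ω : Ω) : Z ω a * Z ω b = ∑ c, ∑ d, M a c * M b d * (N ω c * N ω d) := by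
      simp only [hZdef, mulVec, dotProduct, Finset.sum_mul_sum]
      exact Finset.sum_congr rfl fun c _ => Finset.sum_congr rfl fun d _ => by ring
    have hi (c d : σ) : Integrable (fun ω => M a c * M b d * (N ω c * N ω d)) μ :=
      ((hNL c).integrable_mul (hNL d)).const_mul _
    simp only [h1]
    rw [integral_finsetSum _ fun c _ => integrable_finsetSum _ fun d _ => hi c d]
    simp only [integral_finsetSum _ fun d _ => hi _ d, integral_const_mul, hcov]
    simp only [Matrix.mul_apply, Finset.sum_mul, transpose_apply]
    rw [Finset.sum_comm]
    exact Finset.sum_congr rfl fun c _ => Finset.sum_congr rfl fun d _ => by ring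
  have hZind : iIndepFun (fun a ω => Z ω a) μ := by
    refine HasGaussianLaw.iIndepFun_of_covariance_eq_zero hZ fun a b hab => ?_
    rw [covariance_eq_sub (hZL a) (hZL b)]
    simp [hZmean, hZcov a b, hab]
  have hZlaw : μ.map Z = volume.withDensity fun x => ENNReal.ofReal (stdGaussianDensity x) := by
    have h1 : μ.map Z = _ := hZind.map_fun_eq_pi_map fun a => (hZ.eval a).aemeasurable
    have h2 (a : σ) : μ.map (fun ω => Z ω a) = gaussianReal 0 1 := by
      have h3 := hZcov a a
      rw [(hZ.eval a).map_eq_gaussianReal, variance_eq_sub (hZL a)]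
      simp only [hZmean]
      have : ∫ ω, Z ω a ^ 2 ∂μ = 1 := by simpa [sq] using h3
      simp [this]
    simp only [h1, h2]
    exact pi_gaussianReal_eq_withDensity
  have hg : Measurable fun x : σ → ℝ => ENNReal.ofReal (stdGaussianDensity x) :=
    measurable_stdGaussianDensity.ennreal_ofReal
  have hMm : Measurable (fun x : σ → ℝ => M *ᵥ x) :=
    (LinearMap.toContinuousLinearMap (Matrix.toLin' M)).continuous.measurable
  have hMinv (x : σ → ℝ) : M⁻¹ *ᵥ (M *ᵥ x) = x := by
    rw [Matrix.mulVec_mulVec, Matrix.nonsing_inv_mul _ (isUnit_iff_ne_zero.2 hM0),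
      Matrix.one_mulVec]
  have hfm : Measurable fun x : σ → ℝ =>
      ENNReal.ofReal |M.det| * ENNReal.ofReal (stdGaussianDensity (M *ᵥ x)) :=
    (hg.comp hMm).const_mul _
  have hMinvm : Measurable (fun x : σ → ℝ => M⁻¹ *ᵥ x) :=
    (LinearMap.toContinuousLinearMap (Matrix.toLin' M⁻¹)).continuous.measurable
  have hvol : (volume : Measure (σ → ℝ)).map (fun x => M *ᵥ x) =
      ENNReal.ofReal |M.det⁻¹| • volume := Real.map_matrix_volume_pi_eq_smul_volume_pi hM0
  refine ⟨_, hfm, ?_, fun x => ⟨?_, ?_⟩, ?_⟩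
  · have h1 : μ.map N = (μ.map Z).map fun x => M⁻¹ *ᵥ x := by
      rw [AEMeasurable.map_map_of_aemeasurable hMinvm.aemeasurable hZ.aemeasurable]
      congr 1
      funext ω
      simp [hZdef, hMinv]
    rw [h1, hZlaw]
    ext s hs
    rw [Measure.map_apply hMinvm hs, withDensity_apply _ (hMinvm hs), withDensity_apply _ hs]
    have h2 : (volume : Measure (σ → ℝ)) =
        ENNReal.ofReal |M.det| • (volume : Measure (σ → ℝ)).map (fun x => M *ᵥ x) := by
      rw [hvol, smul_smul, ← ENNReal.ofReal_mul (abs_nonneg _), ← abs_mul,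
        mul_inv_cancel₀ hM0]
      simp
    conv_lhs => rw [h2]
    rw [Measure.restrict_smul, lintegral_smul_measure,
      setLIntegral_map (hMinvm hs) hg hMm, lintegral_const_mul _ (by exact hg.comp hMm),
      smul_eq_mul]
    congr 2
    congr 1
    ext x
    simp [hMinv]
  · exact mul_ne_zero (by simp [hM0]) (by simp [stdGaussianDensity_pos])
  · exact ENNReal.mul_ne_top ENNReal.ofReal_ne_top ENNReal.ofReal_ne_top
  · have h1 (ω : Ω) : Real.log (ENNReal.ofReal |M.det| *
        ENNReal.ofReal (stdGaussianDensity (M *ᵥ N ω))).toReal =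
        -(1 / 2) * Real.log S.det +
          ∑ a, (Real.log (√(2 * Real.pi))⁻¹ - Z ω a ^ 2 / 2) := by
      rw [ENNReal.toReal_mul, ENNReal.toReal_ofReal (abs_nonneg _),
        ENNReal.toReal_ofReal (stdGaussianDensity_pos _).le,
        Real.log_mul (abs_ne_zero.2 hM0) (stdGaussianDensity_pos _).ne', log_stdGaussianDensity,
        Real.log_abs, hdet, Real.log_pow]
      simp [M, Matrix.det_nonsing_inv, hZdef]
    have h2 (a : σ) : Integrable (fun ω => Real.log (√(2 * Real.pi))⁻¹ - Z ω a ^ 2 / 2) μ :=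
      (integrable_const _).sub ((hZL a).integrable_sq.div_const 2)
    simp only [h1]
    refine ⟨(integrable_const _).add (integrable_finsetSum _ fun a _ => h2 a), ?_⟩
    rw [integral_add (integrable_const _) (integrable_finsetSum _ fun a _ => h2 a),
      integral_finsetSum _ fun a _ => h2 a]
    have h3 (a : σ) : ∫ ω, (Real.log (√(2 * Real.pi))⁻¹ - Z ω a ^ 2 / 2) ∂μ =
        Real.log (√(2 * Real.pi))⁻¹ - 1 / 2 := by
      rw [integral_sub (integrable_const _) ((hZL a).integrable_sq.div_const 2),
        integral_div]
      have : ∫ ω, Z ω a ^ 2 ∂μ = 1 := by simpa [sq] using hZcov a a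
      simp [this]
    simp only [h3, integral_const, probReal_univ, one_smul, Finset.sum_const, nsmul_eq_mul,
      Finset.card_univ]

end GaussianDensity

/-! ### Conditional densities in additive noise models -/

section ConditionalDensity

variable {Ω E F : Type*} [MeasurableSpace Ω] [MeasureSpace E] [MeasureSpace F]
  [AddCommGroup F] [MeasurableAdd₂ F] [MeasurableNeg F] [MeasurableSub₂ F]
  [SigmaFinite (volume : Measure E)] [SigmaFinite (volume : Measure F)]
  [(volume : Measure F).IsAddRightInvariant]

/-- If `Y = A X + N` with `N` independent of `X`, the pair `(X, Y)` has density
`f_X(x) f_N(y - A x)`, so that `p_{Y|X}(y|x) = f_N(y - A x)`. -/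
lemma condDensity_of_indep {μ : Measure Ω} [IsProbabilityMeasure μ] {X : Ω → E} {Y N : Ω → F}
    {A : E → F} (hA : Measurable A) (hX : AEMeasurable X μ) (hN : AEMeasurable N μ)
    (hY : ∀ ω, Y ω = N ω + A (X ω)) (hind : IndepFun X N μ)
    (hXac : μ.map X ≪ volume) {f : F → ℝ≥0∞} (hf : Measurable f)
    (hNf : μ.map N = volume.withDensity f) :
    (μ.map fun ω => (X ω, Y ω)) ≪ volume ∧
      ∀ᵐ ω ∂μ, condDensity μ Y X (Y ω) (X ω) = (f (N ω)).toReal := by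
  set g := (μ.map X).rnDeriv volume with hg
  have hgm : Measurable g := Measure.measurable_rnDeriv _ _
  have := Measure.isProbabilityMeasure_map hX
  have := Measure.isProbabilityMeasure_map hN
  have hXg : μ.map X = volume.withDensity g := (Measure.withDensity_rnDeriv_eq _ _ hXac).symm
  -- `(x, n) ↦ (x, n + A x)` preserves volume by translation invariance in the second variable.
  have hshear : MeasurePreserving (fun p : E × F => (p.1, p.2 + A p.1)) volume volume := by
    refine (MeasurePreserving.id (volume : Measure E)).skew_product (g := fun x y => y + A x)
      (by fun_prop) (.of_forall fun x => ?_)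
    exact map_add_right_eq_self _ _
  set d : E × F → ℝ≥0∞ := fun p => g p.1 * f (p.2 - A p.1) with hd
  have hdm : Measurable d := by fun_prop
  have hlaw : (μ.map fun ω => (X ω, Y ω)) = volume.withDensity d := by
    have h1 : (fun ω => (X ω, Y ω)) =
        (fun p : E × F => (p.1, p.2 + A p.1)) ∘ fun ω => (X ω, N ω) := by
      funext ω; simp [hY]
    rw [h1, ← AEMeasurable.map_map_of_aemeasurable hshear.measurable.aemeasurable
      (hX.prodMk hN), (indepFun_iff_map_prod_eq_prod_map_map hX hN).1 hind, hXg, hNf,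
      prod_withDensity hgm hf]
    ext s hs
    rw [Measure.map_apply hshear.measurable hs, withDensity_apply _ (hshear.measurable hs),
      withDensity_apply _ hs, ← hshear.setLIntegral_comp_preimage hs hdm]
    simp [hd, Measure.volume_eq_prod]
  have hac : (μ.map fun ω => (X ω, Y ω)) ≪ volume := hlaw ▸ withDensity_absolutelyContinuous _ _
  refine ⟨hac, ?_⟩
  have hYm : AEMeasurable Y μ := by
    rw [show Y = fun ω => N ω + A (X ω) from funext hY]
    exact hN.add (hA.comp_aemeasurable hX)
  have hf1 : ∫⁻ y, f y = 1 := by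
    rw [← setLIntegral_univ, ← withDensity_apply _ MeasurableSet.univ, ← hNf, measure_univ]
  have hjd : jointDensity μ X Y =ᵐ[volume] d := by
    rw [jointDensity, hlaw]; exact Measure.rnDeriv_withDensity _ hdm
  have hmarg : ∀ᵐ x : E, ∫⁻ y, jointDensity μ X Y (x, y) = g x := by
    have h2 : ∀ᵐ x : E, ∀ᵐ y : F, jointDensity μ X Y (x, y) = d (x, y) :=
      Measure.ae_ae_of_ae_prod hjd
    filter_upwards [h2] with x hx
    rw [lintegral_congr_ae hx]
    simp only [hd]
    rw [lintegral_const_mul _ (by fun_prop), lintegral_sub_right_eq_self f (A x), hf1, mul_one]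
  have e1 : ∀ᵐ ω ∂μ, jointDensity μ X Y (X ω, Y ω) = d (X ω, Y ω) :=
    ae_of_ae_map (hX.prodMk hYm) (hac.ae_le hjd)
  have e2 : ∀ᵐ ω ∂μ, ∫⁻ y, jointDensity μ X Y (X ω, y) = g (X ω) :=
    ae_of_ae_map hX (hXac.ae_le hmarg)
  -- The quotient defining the conditional density is genuine: `0 < g(X) < ∞` almost surely.
  have e3 : ∀ᵐ ω ∂μ, g (X ω) ≠ 0 := by
    have h3 : ∀ᵐ x ∂(μ.map X), g x ≠ 0 := (Measure.rnDeriv_pos hXac).mono fun x hx => hx.ne'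
    exact ae_of_ae_map hX h3
  have e4 : ∀ᵐ ω ∂μ, g (X ω) ≠ ∞ :=
    ae_of_ae_map hX (hXac.ae_le ((Measure.rnDeriv_lt_top _ _).mono fun x hx => hx.ne))
  filter_upwards [e1, e2, e3, e4] with ω h1 h2 h3 h4
  rw [condDensity, h1, h2, hd]
  simp only [hY, add_sub_cancel_right]
  rw [mul_comm, ENNReal.mul_div_cancel_right h3 h4]

end ConditionalDensity

/-! ### Block Toeplitz forms and their symbols -/

section SpectralBounds

lemma integral_fourier (n : ℤ) :
    ∫ t : AddCircle (1 : ℝ), fourier n t ∂AddCircle.haarAddCircle = if n = 0 then 1 else 0 := by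
  have h := congrFun (fourierCoeff_fourier (T := (1 : ℝ)) n) 0
  simpa [fourierCoeff, Pi.single_apply, eq_comm] using h

lemma norm_fourier_apply (n : ℤ) (t : AddCircle (1 : ℝ)) : ‖fourier n t‖ = 1 := by
  rw [fourier_apply]; exact Circle.norm_coe _

/-- Fourier inversion for an absolutely convergent trigonometric series. -/
lemma integral_fourier_mul_of_hasSum {r : ℤ → ℂ} (hr : Summable fun m => ‖r m‖)
    {φ : AddCircle (1 : ℝ) → ℂ} (hφ : ∀ t, HasSum (fun m : ℤ => fourier (-m) t * r m) (φ t))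
    (n : ℤ) :
    Integrable (fun t => fourier n t * φ t) AddCircle.haarAddCircle ∧
      ∫ t, fourier n t * φ t ∂AddCircle.haarAddCircle = r n := by
  have hcont : Continuous φ := by
    have h1 : φ = fun t => ∑' m : ℤ, fourier (-m) t * r m := funext fun t => (hφ t).tsum_eq.symm
    rw [h1]
    refine continuous_tsum (fun m => (fourier (-m)).continuous.mul continuous_const) hr
      fun m t => ?_
    rw [norm_mul, norm_fourier_apply, one_mul]
  refine ⟨((fourier n).continuous.mul hcont).integrable_of_hasCompactSupport
    (HasCompactSupport.of_compactSpace _), ?_⟩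
  have hF (m : ℤ) : Integrable (fun t : AddCircle (1 : ℝ) => fourier (n - m) t * r m)
      AddCircle.haarAddCircle :=
    ((fourier (n - m)).continuous.mul continuous_const).integrable_of_hasCompactSupport
      (HasCompactSupport.of_compactSpace _)
  have h2 := hasSum_integral_of_summable_integral_norm hF (by
    simpa only [norm_mul, norm_fourier_apply, one_mul, integral_const, probReal_univ, one_smul]
      using hr)
  have h3 (t : AddCircle (1 : ℝ)) : ∑' m : ℤ, fourier (n - m) t * r m = fourier n t * φ t := by
    rw [← (hφ t).tsum_eq, ← tsum_mul_left]
    refine tsum_congr fun m => ?_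
    rw [sub_eq_add_neg, fourier_add, mul_assoc]
  simp only [h3, integral_mul_const, integral_fourier, sub_eq_zero] at h2
  refine h2.unique ?_
  have h4 := hasSum_single (f := fun m => (if n = m then (1 : ℂ) else 0) * r m) n
    fun m hm => by rw [if_neg hm.symm, zero_mul]
  rwa [if_pos rfl, one_mul] at h4

variable {σ : Type*} [Fintype σ]

omit [Fintype σ] in
lemma hasSum_matrix_apply {f : ℤ → Matrix σ σ ℂ} {M : Matrix σ σ ℂ} (h : HasSum f M) (a b : σ) :
    HasSum (fun m => f m a b) (M a b) :=
  Pi.hasSum.1 (Pi.hasSum.1 h a) b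

/-- A block Toeplitz form is nonnegative if its symbol is positive semidefinite on the unit
circle: it is the integral of the symbol against trigonometric polynomials. -/
lemma toeplitz_form_nonneg {r : ℤ → Matrix σ σ ℝ} {Φ : ℂ → Matrix σ σ ℂ}
    (hΦ : ∀ ζ : ℂ, ‖ζ‖ = 1 → HasSum (fun m : ℤ => ζ ^ (-m) • (r m).map Complex.ofReal) (Φ ζ))
    (hpos : ∀ ζ : ℂ, ‖ζ‖ = 1 → (Φ ζ).PosSemidef) (s : Finset ℤ) (c : ℤ → σ → ℝ) :
    0 ≤ ∑ j ∈ s, ∑ k ∈ s, ∑ a, ∑ b, c j a * c k b * r (j - k) a b := by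
  have hr (a b : σ) : Summable fun m => ‖(r m a b : ℂ)‖ := by
    have h := (hasSum_matrix_apply (hΦ 1 (by simp)) a b).summable.norm
    simpa using h
  set ζ : AddCircle (1 : ℝ) → ℂ := fun t => fourier 1 t
  have hζ (t) : ‖ζ t‖ = 1 := norm_fourier_apply 1 t
  have hζn (n : ℤ) (t) : ζ t ^ n = fourier n t := by
    simp only [ζ, fourier_apply, one_zsmul, AddCircle.toCircle_zsmul, Circle.coe_zpow]
  have hφ (a b : σ) (t) : HasSum (fun m : ℤ => fourier (-m) t * (r m a b : ℂ)) (Φ (ζ t) a b) := by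
    have h := hasSum_matrix_apply (hΦ (ζ t) (hζ t)) a b
    simpa [hζn] using h
  have hI (n : ℤ) (a b : σ) := integral_fourier_mul_of_hasSum (hr a b) (hφ a b) n
  -- The trigonometric polynomial with coefficients `c`, evaluated on the circle.
  set x : AddCircle (1 : ℝ) → σ → ℂ := fun t b => ∑ k ∈ s, (c k b : ℂ) * fourier (-k) t
  have hx (t) : star (x t) ⬝ᵥ (Φ (ζ t) *ᵥ x t) = ∑ j ∈ s, ∑ k ∈ s, ∑ a, ∑ b,
      ((c j a * c k b : ℝ) : ℂ) * (fourier (j - k) t * Φ (ζ t) a b) := by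
    have h1 (a : σ) : star (x t) a = ∑ j ∈ s, (c j a : ℂ) * fourier j t := by
      simp [x, ← fourier_neg, -fourier_apply]
    simp only [dotProduct, mulVec, h1]
    have h2 : ∑ j ∈ s, ∑ k ∈ s, ∑ a, ∑ b,
        ((c j a * c k b : ℝ) : ℂ) * (fourier (j - k) t * Φ (ζ t) a b) =
        ∑ a, ∑ b, ∑ j ∈ s, ∑ k ∈ s,
          ((c j a * c k b : ℝ) : ℂ) * (fourier (j - k) t * Φ (ζ t) a b) := by
      simp only [Finset.sum_comm (s := s) (t := Finset.univ)]
    rw [h2]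
    refine Finset.sum_congr rfl fun a _ => ?_
    rw [Finset.mul_sum]
    refine Finset.sum_congr rfl fun b _ => ?_
    simp only [x]
    rw [Finset.mul_sum, Finset.sum_mul_sum]
    refine Finset.sum_congr rfl fun j _ => Finset.sum_congr rfl fun k _ => ?_
    rw [sub_eq_add_neg, fourier_add]
    push_cast
    ring
  have hint : ∫ t, star (x t) ⬝ᵥ (Φ (ζ t) *ᵥ x t) ∂AddCircle.haarAddCircle =
      ((∑ j ∈ s, ∑ k ∈ s, ∑ a, ∑ b, c j a * c k b * r (j - k) a b : ℝ) : ℂ) := by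
    have hi (j k : ℤ) (a b : σ) : Integrable (fun t => ((c j a * c k b : ℝ) : ℂ) *
        (fourier (j - k) t * Φ (ζ t) a b)) AddCircle.haarAddCircle :=
      (hI (j - k) a b).1.const_mul _
    simp only [hx]
    rw [integral_finsetSum _ fun j _ => integrable_finsetSum _ fun k _ =>
      integrable_finsetSum _ fun a _ => integrable_finsetSum _ fun b _ => hi j k a b]
    simp only [integral_finsetSum _ fun k _ =>
      integrable_finsetSum _ fun a _ => integrable_finsetSum _ fun b _ => hi _ k a b,
      integral_finsetSum _ fun a _ => integrable_finsetSum _ fun b _ => hi _ _ a b,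
      integral_finsetSum _ fun b _ => hi _ _ _ b, integral_const_mul, (hI _ _ _).2]
    push_cast
    rfl
  have h0 : (0 : ℂ) ≤ ∫ t, star (x t) ⬝ᵥ (Φ (ζ t) *ᵥ x t) ∂AddCircle.haarAddCircle :=
    integral_nonneg fun t => (hpos (ζ t) (hζ t)).dotProduct_mulVec_nonneg (x t)
  rw [hint] at h0
  exact_mod_cast h0

end SpectralBounds

/-! ### Stationary processes as families in `L²` -/

section StationaryProcess

open scoped InnerProductSpace

variable {Ω σ : Type*} [MeasurableSpace Ω] {μ : Measure Ω} [Fintype σ] {w : ℤ → Ω → σ → ℝ}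

omit [Fintype σ] in
lemma IsStationary.integral_mul_shift (hw : IsStationary μ w) (h k j : ℤ) (a b : σ) :
    ∫ ω, w (k + h) ω a * w (j + h) ω b ∂μ = ∫ ω, w k ω a * w j ω b ∂μ := by
  have hm : Measurable fun p : ℤ → σ → ℝ => p k a * p j b := by fun_prop
  exact ((hw h).comp hm).integral_eq

/-- The components of a square integrable process as elements of `L²`. -/
def coordLp (hL : ∀ k a, MemLp (fun ω => w k ω a) 2 μ) (k : ℤ) (a : σ) : Lp ℝ 2 μ :=
  (hL k a).toLp

omit [Fintype σ] in
lemma inner_toLp {f g : Ω → ℝ} (hf : MemLp f 2 μ) (hg : MemLp g 2 μ) :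
    ⟪hf.toLp, hg.toLp⟫_ℝ = ∫ ω, f ω * g ω ∂μ := by
  rw [L2.inner_def]
  refine integral_congr_ae ?_
  filter_upwards [hf.coeFn_toLp, hg.coeFn_toLp] with ω h1 h2
  simp [h1, h2, mul_comm]

/-- Bounds on the spectral density are bounds on the covariance form: both
`Φ - cmin I` and `cmax I - Φ` are symbols of block Toeplitz forms. -/
lemma isStationaryRiesz_coordLp [DecidableEq σ] (hw : IsStationary μ w)
    (hL : ∀ k a, MemLp (fun ω => w k ω a) 2 μ) {cmin cmax : ℝ} (hcmin : 0 < cmin)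
    (hb : PSDBounds μ w cmin cmax) : IsStationaryRiesz (coordLp hL) cmin cmax := by
  have hR (j k : ℤ) (a b : σ) : ⟪coordLp hL j a, coordLp hL k b⟫_ℝ = autocov μ w (j - k) a b := by
    rw [coordLp, coordLp, inner_toLp, autocov, Matrix.of_apply,
      ← hw.integral_mul_shift k (j - k) 0 a b]
    simp
  have hnorm (s : Finset ℤ) (c : ℤ → σ → ℝ) : ‖∑ k ∈ s, ∑ a, c k a • coordLp hL k a‖ ^ 2 =
      ∑ j ∈ s, ∑ k ∈ s, ∑ a, ∑ b, c j a * c k b * autocov μ w (j - k) a b := by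
    rw [← real_inner_self_eq_norm_sq]
    simp only [sum_inner]
    simp only [inner_sum, real_inner_smul_left, real_inner_smul_right, hR]
    refine Finset.sum_congr rfl fun j _ => ?_
    rw [Finset.sum_comm]
    refine Finset.sum_congr rfl fun k _ => Finset.sum_congr rfl fun a _ =>
      Finset.sum_congr rfl fun b _ => by ring
  have hdelta (d : ℝ) (s : Finset ℤ) (c : ℤ → σ → ℝ) : ∑ j ∈ s, ∑ k ∈ s, ∑ a, ∑ b,
      c j a * c k b * (if j - k = 0 then d • (1 : Matrix σ σ ℝ) else 0) a b =
        d * ∑ k ∈ s, ∑ a, c k a ^ 2 := by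
    rw [Finset.mul_sum]
    refine Finset.sum_congr rfl fun j hj => ?_
    rw [Finset.sum_eq_single j (fun k _ hk => by simp [sub_eq_zero, hk.symm])
      (fun h => absurd hj h), Finset.mul_sum]
    refine Finset.sum_congr rfl fun a _ => ?_
    rw [Finset.sum_eq_single a (fun b _ hb => by simp [hb.symm]) (by simp)]
    simp
    ring
  have hconst (d : ℝ) (ζ : ℂ) : HasSum (fun m : ℤ => ζ ^ (-m) •
      (if m = 0 then d • (1 : Matrix σ σ ℝ) else 0).map Complex.ofReal)
      ((d : ℂ) • (1 : Matrix σ σ ℂ)) := by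
    convert hasSum_ite_eq (0 : ℤ) ((d : ℂ) • (1 : Matrix σ σ ℂ)) using 2 with m
    split_ifs with h
    · subst h
      ext a b
      simp [Matrix.one_apply, apply_ite Complex.ofReal]
    · ext a b; simp
  have hpsd (ζ : ℂ) (hζ : ‖ζ‖ = 1) : HasSum (fun m : ℤ => ζ ^ (-m) •
      (autocov μ w m).map Complex.ofReal) (psd μ w ζ) := (hb.summable ζ hζ).hasSum
  refine ⟨hcmin, fun h k j a b => ?_, fun s c => ?_, fun s c => ?_⟩
  · rw [hR, hR, add_sub_add_right_eq_sub]
  · have h1 := toeplitz_form_nonneg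
      (r := fun m => autocov μ w m - if m = 0 then cmin • (1 : Matrix σ σ ℝ) else 0)
      (fun ζ hζ => (congrArg (HasSum · _) (funext fun m => by
        rw [Matrix.map_sub _ Complex.ofReal_sub, smul_sub])).mpr
          ((hpsd ζ hζ).sub (hconst cmin ζ))) hb.lower s c
    simp only [Matrix.sub_apply, mul_sub, Finset.sum_sub_distrib, hdelta] at h1
    rw [hnorm]; linarith
  · have h1 := toeplitz_form_nonneg
      (r := fun m => (if m = 0 then cmax • (1 : Matrix σ σ ℝ) else 0) - autocov μ w m)
      (fun ζ hζ => (congrArg (HasSum · _) (funext fun m => by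
        rw [Matrix.map_sub _ Complex.ofReal_sub, smul_sub])).mpr
          ((hconst cmax ζ).sub (hpsd ζ hζ))) hb.upper s c
    simp only [Matrix.sub_apply, mul_sub, Finset.sum_sub_distrib, hdelta] at h1
    rw [hnorm]; linarith

end StationaryProcess

/-! ### Optimal predictors and their error covariances -/

section OptimalPredictor

open scoped InnerProductSpace

variable {Ω σ : Type*} [MeasurableSpace Ω] {μ : Measure Ω} [Fintype σ] {u : ℤ → Ω → σ → ℝ}

omit [MeasurableSpace Ω] in
lemma partialPrediction_apply (u : ℤ → Ω → σ → ℝ) (Θ : ℕ → Matrix σ σ ℝ) (n : ℕ) (k : ℤ) (ω : Ω)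
    (a : σ) : partialPrediction u Θ n k ω a =
      ∑ i ∈ Finset.Icc 1 n, ∑ b, Θ i a b * u (k - (i : ℤ)) ω b := by
  simp [partialPrediction, mulVec, dotProduct]

lemma memLp_partialPrediction (hL : ∀ k a, MemLp (fun ω => u k ω a) 2 μ)
    (Θ : ℕ → Matrix σ σ ℝ) (n : ℕ) (k : ℤ) (a : σ) :
    MemLp (fun ω => partialPrediction u Θ n k ω a) 2 μ := by
  simp only [partialPrediction_apply]
  exact memLp_finsetSum _ fun i _ => memLp_finsetSum _ fun b _ => (hL _ b).const_mul _

omit [Fintype σ] in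
lemma toLp_finsetSum {ι : Type*} (s : Finset ι) {f : ι → Ω → ℝ} (hf : ∀ i, MemLp (f i) 2 μ) :
    (memLp_finsetSum s fun i _ => hf i).toLp (fun ω => ∑ i ∈ s, f i ω) =
      ∑ i ∈ s, (hf i).toLp := by
  classical
  induction s using Finset.induction_on with
  | empty => exact MemLp.toLp_zero _
  | insert i s hi ih =>
    rw [Finset.sum_insert hi, ← ih, ← MemLp.toLp_add]
    exact MemLp.toLp_congr _ _ (.of_forall fun ω => Finset.sum_insert hi)

lemma toLp_partialPrediction (hL : ∀ k a, MemLp (fun ω => u k ω a) 2 μ)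
    (Θ : ℕ → Matrix σ σ ℝ) (n : ℕ) (k : ℤ) (a : σ) :
    (memLp_partialPrediction hL Θ n k a).toLp = filterSum (coordLp hL) Θ n k a := by
  have h (i : ℕ) (b : σ) : MemLp (fun ω => Θ i a b * u (k - (i : ℤ)) ω b) 2 μ :=
    (hL _ b).const_mul _
  have h1 : (memLp_partialPrediction hL Θ n k a).toLp =
      (memLp_finsetSum (Finset.Icc 1 n) fun i _ =>
        memLp_finsetSum Finset.univ fun b _ => h i b).toLp _ :=
    MemLp.toLp_congr _ _ (.of_forall fun ω => partialPrediction_apply u Θ n k ω a)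
  rw [h1, toLp_finsetSum _ fun i => memLp_finsetSum Finset.univ fun b _ => h i b]
  refine Finset.sum_congr rfl fun i _ => ?_
  rw [toLp_finsetSum _ fun b => h i b]
  rfl

lemma mse_eq_sum {f g : Ω → σ → ℝ} (hf : ∀ a, MemLp (fun ω => f ω a) 2 μ)
    (hg : ∀ a, MemLp (fun ω => g ω a) 2 μ) :
    mse μ f g = ∑ a, ‖(hf a).toLp - (hg a).toLp‖ ^ 2 := by
  have h (a : σ) := (hf a).sub (hg a)
  simp only [← MemLp.toLp_sub, ← real_inner_self_eq_norm_sq, inner_toLp]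
  exact integral_finsetSum _ fun a _ => (h a).integrable_mul (h a)

/-- Mean-square convergence of vectors, in the supremum norm of `σ → ℝ`, gives convergence of each
component in `L²`. -/
lemma tendsto_toLp_of_tendsto_eLpNorm {f : Ω → σ → ℝ} {g : ℕ → Ω → σ → ℝ}
    (hf : ∀ a, MemLp (fun ω => f ω a) 2 μ) (hg : ∀ n a, MemLp (fun ω => g n ω a) 2 μ)
    (h : Tendsto (fun n => eLpNorm (f - g n) 2 μ) atTop (𝓝 0)) (a : σ) :
    Tendsto (fun n => (hg n a).toLp) atTop (𝓝 (hf a).toLp) := by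
  rw [Lp.tendsto_Lp_iff_tendsto_eLpNorm'']
  refine tendsto_of_tendsto_of_tendsto_of_le_of_le tendsto_const_nhds h (fun _ => zero_le)
    fun n => eLpNorm_mono fun ω => ?_
  rw [← norm_neg]
  simpa using norm_le_pi_norm (f ω - g n ω) a

lemma tendsto_eLpNorm_of_tendsto_toLp {f : Ω → σ → ℝ} {g : ℕ → Ω → σ → ℝ}
    (hf : ∀ a, MemLp (fun ω => f ω a) 2 μ) (hg : ∀ n a, MemLp (fun ω => g n ω a) 2 μ)
    (h : ∀ a, Tendsto (fun n => (hg n a).toLp) atTop (𝓝 (hf a).toLp)) :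
    Tendsto (fun n => eLpNorm (f - g n) 2 μ) atTop (𝓝 0) := by
  have h1 : Tendsto (fun n => ∑ a, eLpNorm ((fun ω => g n ω a) - fun ω => f ω a) 2 μ) atTop
      (𝓝 0) := by
    rw [show (0 : ℝ≥0∞) = ∑ _a : σ, 0 by simp]
    exact tendsto_finsetSum _ fun a _ =>
      (Lp.tendsto_Lp_iff_tendsto_eLpNorm'' _ (fun n => hg n a) _ (hf a)).1 (h a)
  refine tendsto_of_tendsto_of_tendsto_of_le_of_le tendsto_const_nhds h1 (fun _ => zero_le)
    fun n => ?_
  have h2 : eLpNorm (f - g n) 2 μ ≤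
      eLpNorm (∑ a, fun ω => ‖g n ω a - f ω a‖) 2 μ := by
    refine eLpNorm_mono fun ω => ?_
    rw [Finset.sum_apply, Real.norm_of_nonneg (Finset.sum_nonneg fun _ _ => norm_nonneg _)]
    refine (pi_norm_le_iff_of_nonneg (Finset.sum_nonneg fun _ _ => norm_nonneg _)).2 fun a => ?_
    rw [Pi.sub_apply, Pi.sub_apply, norm_sub_rev]
    exact Finset.single_le_sum (f := fun a => ‖g n ω a - f ω a‖) (fun _ _ => norm_nonneg _)
      (Finset.mem_univ a)
  refine h2.trans ((eLpNorm_sum_le (fun a _ => ((hg n a).sub (hf a)).1.norm) one_le_two).trans ?_)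
  exact (Finset.sum_congr rfl fun a _ => eLpNorm_norm _).le

lemma posDef_of_inner {H : Type*} [NormedAddCommGroup H] [InnerProductSpace ℝ H]
    {S : Matrix σ σ ℝ} {e : σ → H} (hS : ∀ a b, S a b = ⟪e a, e b⟫_ℝ) {m : ℝ} (hm : 0 < m)
    (hlower : ∀ c : σ → ℝ, m * ∑ a, c a ^ 2 ≤ ‖∑ a, c a • e a‖ ^ 2) : S.PosDef := by
  refine Matrix.posDef_iff_dotProduct_mulVec.2 ⟨?_, fun c hc => ?_⟩
  · ext a b
    simp [hS, real_inner_comm]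
  · have h1 : star c ⬝ᵥ (S *ᵥ c) = ‖∑ a, c a • e a‖ ^ 2 := by
      rw [← real_inner_self_eq_norm_sq]
      simp only [sum_inner, inner_sum, real_inner_smul_left, real_inner_smul_right, dotProduct,
        mulVec, hS, Finset.mul_sum, star_trivial]
      rw [Finset.sum_comm]
      exact Finset.sum_congr rfl fun a _ => Finset.sum_congr rfl fun b _ => by
        rw [real_inner_comm]; ring
    rw [h1]
    refine lt_of_lt_of_le (mul_pos hm ?_) (hlower c)
    obtain ⟨a, ha⟩ := Function.ne_iff.1 hc
    exact Finset.sum_pos' (fun _ _ => sq_nonneg _) ⟨a, Finset.mem_univ a, sq_pos_of_ne_zero ha⟩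

/-- The projections onto the infinite pasts form an optimal predictor. -/
lemma exists_isOptimalPredictor (hL : ∀ k a, MemLp (fun ω => u k ω a) 2 μ) {cmin cmax : ℝ}
    (hU : IsStationaryRiesz (coordLp hL) cmin cmax) :
    ∃ H uhat, IsOptimalPredictor μ u H uhat := by
  obtain ⟨H, hH⟩ := hU.exists_tendsto_filterSum
  set P : ℤ → σ → Lp ℝ 2 μ := fun k a =>
    (infinitePast (coordLp hL) k).starProjection (coordLp hL k a)
  have hP (k : ℤ) (a : σ) : MemLp (fun ω => P k a ω) 2 μ := Lp.memLp _
  have hPt (k : ℤ) (a : σ) : (hP k a).toLp = P k a := Lp.toLp_coeFn _ _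
  refine ⟨H, fun k ω a => P k a ω, fun k => MemLp.of_eval (hP k), fun k => ?_, fun k n Θ => ?_⟩
  · refine tendsto_eLpNorm_of_tendsto_toLp (hP k) (memLp_partialPrediction hL H · k) fun a => ?_
    simp only [toLp_partialPrediction hL, hPt]
    exact hH k a
  · rw [mse_eq_sum (hL k) (hP k), mse_eq_sum (hL k) (memLp_partialPrediction hL Θ n k)]
    refine Finset.sum_le_sum fun a _ => ?_
    rw [hPt, toLp_partialPrediction hL]
    refine pow_le_pow_left₀ (norm_nonneg _) ?_ 2
    have hmem := filterSum_mem_infinitePast (U := coordLp hL) Θ n k a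
    change ‖coordLp hL k a - _‖ ≤ ‖coordLp hL k a - _‖
    rw [Submodule.starProjection_minimal]
    exact ciInf_le ⟨0, by rintro _ ⟨x, rfl⟩; exact norm_nonneg _⟩
      (⟨_, hmem⟩ : infinitePast (coordLp hL) k)

/-- The error covariance of an optimal predictor does not depend on the time, is positive definite
and is the limit of the error covariances of the optimal predictors from finite pasts. -/
lemma IsOptimalPredictor.exists_errorCov (hL : ∀ k a, MemLp (fun ω => u k ω a) 2 μ)
    {cmin cmax : ℝ} (hU : IsStationaryRiesz (coordLp hL) cmin cmax)
    {H : ℕ → Matrix σ σ ℝ} {uhat : ℤ → Ω → σ → ℝ} (h : IsOptimalPredictor μ u H uhat) :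
    ∃ S : Matrix σ σ ℝ, (∀ k, errorCov μ u uhat k = S) ∧ S.PosDef ∧
      ∃ Θ : ℕ → ℕ → Matrix σ σ ℝ, ∃ G : ℕ → Matrix σ σ ℝ,
        (∀ n, errorCov μ u (partialPrediction u (Θ n) n) n = G n) ∧ (∀ n, (G n).PosDef) ∧
        (∀ n (j : ℕ) a b, j < n →
          ∫ ω, (u n ω a - partialPrediction u (Θ n) n n ω a) * u j ω b ∂μ = 0) ∧
        Tendsto G atTop (𝓝 S) := by
  choose Θ hΘ0 hΘ using hU.exists_filter_eq_starProjection
  have hhat (k : ℤ) (a : σ) : MemLp (fun ω => uhat k ω a) 2 μ := (h.memLp k).eval a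
  have hproj (k : ℤ) (a : σ) : (hhat k a).toLp =
      (infinitePast (coordLp hL) k).starProjection (coordLp hL k a) := by
    refine hU.eq_starProjection_of_optimal (W := fun a => (hhat k a).toLp) (Θ := H)
      (fun a => ?_) (fun n Ξ => ?_) a
    · simp only [← toLp_partialPrediction hL]
      exact tendsto_toLp_of_tendsto_eLpNorm (hhat k) (memLp_partialPrediction hL H · k)
        (h.tendsto k) a
    · have := h.optimal k n Ξ
      rw [mse_eq_sum (hL k) (hhat k), mse_eq_sum (hL k) (memLp_partialPrediction hL Ξ n k)] at this
      simp only [toLp_partialPrediction hL] at this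
      exact this
  set e : ℤ → σ → Lp ℝ 2 μ := fun k a => coordLp hL k a -
    (infinitePast (coordLp hL) k).starProjection (coordLp hL k a) with he
  set d : ℕ → ℤ → σ → Lp ℝ 2 μ := fun n k a => coordLp hL k a -
    filterSum (coordLp hL) (Θ n) n k a with hd
  have hde (k : ℤ) (a : σ) : Tendsto (fun n => d n k a) atTop (𝓝 (e k a)) := by
    simp only [hd, hΘ]
    exact (tendsto_starProjection_past _ k _).const_sub _
  have hcov (k : ℤ) (a b : σ) : errorCov μ u uhat k a b = ⟪e k a, e k b⟫_ℝ := by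
    simp only [he, ← hproj]
    simp only [coordLp, ← MemLp.toLp_sub, inner_toLp]
    rfl
  have hcovn (n : ℕ) (k : ℤ) (a b : σ) :
      errorCov μ u (partialPrediction u (Θ n) n) k a b = ⟪d n k a, d n k b⟫_ℝ := by
    simp only [hd, ← toLp_partialPrediction hL]
    simp only [coordLp, ← MemLp.toLp_sub, inner_toLp]
    rfl
  have hlimk (k : ℤ) (a b : σ) : Tendsto (fun n => ⟪d n 0 a, d n 0 b⟫_ℝ) atTop
      (𝓝 ⟪e k a, e k b⟫_ℝ) := by
    have h1 (n : ℕ) : ⟪d n 0 a, d n 0 b⟫_ℝ = ⟪d n k a, d n k b⟫_ℝ :=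
      hU.inner_residual (Θ n) n 0 k a b
    simp only [h1]
    exact (hde k a).inner (hde k b)
  refine ⟨Matrix.of fun a b => ⟪e 0 a, e 0 b⟫_ℝ, fun k => ?_, ?_, Θ,
    fun n => Matrix.of fun a b => ⟪d n 0 a, d n 0 b⟫_ℝ, fun n => ?_, fun n => ?_, ?_, ?_⟩
  · ext a b
    rw [hcov]
    exact tendsto_nhds_unique (hlimk k a b) (hlimk 0 a b)
  · refine posDef_of_inner (e := e 0) (fun _ _ => rfl) hU.cmin_pos fun c => ?_
    exact ge_of_tendsto' ((tendsto_finsetSum _ fun a _ =>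
      (hde 0 a).const_smul (c a)).norm.pow 2) fun n => hU.lower_residual (Θ n) n 0 c
  · ext a b
    rw [hcovn]
    exact hU.inner_residual (Θ n) n n 0 a b
  · exact posDef_of_inner (e := d n 0) (fun _ _ => rfl) hU.cmin_pos
      fun c => hU.lower_residual (Θ n) n 0 c
  · intro n j a b hj
    have h1 : ⟪d n n a, coordLp hL j b⟫_ℝ = 0 := by
      simp only [hd, hΘ]
      refine Submodule.starProjection_inner_eq_zero _ _ ?_
      have := mem_past (U := coordLp hL) (n := n) (i := n - j) (by omega) (by omega) n b
      rwa [Nat.cast_sub hj.le, sub_sub_cancel] at this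
    simp only [hd, ← toLp_partialPrediction hL] at h1
    simp only [coordLp, ← MemLp.toLp_sub, inner_toLp] at h1
    exact h1
  · exact tendsto_pi_nhds.2 fun a => tendsto_pi_nhds.2 fun b => hlimk 0 a b

end OptimalPredictor

/-! ### Conditional densities given the finite past -/

section GaussianPrediction

open scoped InnerProductSpace

variable {Ω σ κ : Type*} [MeasurableSpace Ω] {μ : Measure Ω} [Fintype σ] [Fintype κ]
  {u : ℤ → Ω → σ → ℝ}

/-- The stretch `u[0], …, u[n-1]` as a single vector. -/
def pastVector (u : ℤ → Ω → σ → ℝ) (n : ℕ) (ω : Ω) : Fin n × σ → ℝ :=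
  fun p => u (p.1 : ℕ) ω p.2

/-- The matrix by which the filter `Θ`, truncated after `n` steps, predicts the components `e` of
`u[n]` from `pastVector u n`: the value `u[j]` is `n - j` steps old. -/
def pastFilter (Θ : ℕ → Matrix σ σ ℝ) (n : ℕ) (e : κ → σ) : Matrix κ (Fin n × σ) ℝ :=
  Matrix.of fun a p => Θ (n - p.1) (e a) p.2

omit [MeasurableSpace Ω] [Fintype κ] in
lemma pastFilter_mulVec_pastVector (Θ : ℕ → Matrix σ σ ℝ) (n : ℕ) (e : κ → σ) (ω : Ω) (a : κ) :
    (pastFilter Θ n e *ᵥ pastVector u n ω) a = partialPrediction u Θ n n ω (e a) := by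
  rw [partialPrediction_apply, mulVec, dotProduct, Fintype.sum_prod_type]
  simp only [pastFilter, pastVector, Matrix.of_apply]
  rw [Fin.sum_univ_eq_sum_range (fun j => ∑ b, Θ (n - j) (e a) b * u (j : ℤ) ω b) n]
  refine Finset.sum_nbij' (fun j => n - j) (fun i => n - i) ?_ ?_ ?_ ?_ fun j hj => ?_
  · intro j hj; simp only [Finset.mem_range, Finset.mem_Icc] at *; omega
  · intro j hj; simp only [Finset.mem_range, Finset.mem_Icc] at *; omega
  · intro j hj; simp only [Finset.mem_range] at *; omega
  · intro j hj; simp only [Finset.mem_Icc] at *; omega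
  · have : j ≤ n := (Finset.mem_range.1 hj).le
    rw [Nat.cast_sub this, sub_sub_cancel]

omit [Fintype κ] in
lemma hasGaussianLaw_pastVector_prod [Finite κ] (hu : IsGaussianProcess u μ) (n : ℕ) (e : κ → σ) :
    HasGaussianLaw (fun ω => (pastVector u n ω, fun a => u n ω (e a))) μ := by
  have := Fintype.ofFinite κ
  set I : Finset ℤ := (Finset.range (n + 1)).image fun j : ℕ => (j : ℤ)
  have hI (j : ℕ) (hj : j ≤ n) : (j : ℤ) ∈ I :=
    Finset.mem_image_of_mem _ (Finset.mem_range.2 (by omega))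
  let L : (I → σ → ℝ) →L[ℝ] (Fin n × σ → ℝ) × (κ → ℝ) :=
    (ContinuousLinearMap.pi fun p =>
      (ContinuousLinearMap.proj (R := ℝ) (φ := fun _ : σ => ℝ) p.2).comp
        (ContinuousLinearMap.proj (R := ℝ) (φ := fun _ : I => σ → ℝ)
          ⟨((p.1 : ℕ) : ℤ), hI _ p.1.2.le⟩)).prod
    (ContinuousLinearMap.pi fun a =>
      (ContinuousLinearMap.proj (R := ℝ) (φ := fun _ : σ => ℝ) (e a)).comp
        (ContinuousLinearMap.proj (R := ℝ) (φ := fun _ : I => σ → ℝ) ⟨(n : ℤ), hI _ le_rfl⟩))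
  exact (hu.hasGaussianLaw I).map_fun L

lemma hasGaussianLaw_pastVector_residual (hu : IsGaussianProcess u μ) (Θ : ℕ → Matrix σ σ ℝ)
    (n : ℕ) (e : κ → σ) :
    HasGaussianLaw (fun ω => (pastVector u n ω,
      fun a => u n ω (e a) - partialPrediction u Θ n n ω (e a))) μ := by
  let A : (Fin n × σ → ℝ) →L[ℝ] κ → ℝ :=
    LinearMap.toContinuousLinearMap (pastFilter Θ n e).mulVecLin
  let L : (Fin n × σ → ℝ) × (κ → ℝ) →L[ℝ] (Fin n × σ → ℝ) × (κ → ℝ) :=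
    (ContinuousLinearMap.fst ℝ _ _).prod
      (ContinuousLinearMap.snd ℝ _ _ - A.comp (ContinuousLinearMap.fst ℝ _ _))
  have h := (hasGaussianLaw_pastVector_prod hu n e).map_fun L
  have h1 (ω : Ω) : (pastVector u n ω,
      fun a => u n ω (e a) - partialPrediction u Θ n n ω (e a)) =
      L (pastVector u n ω, fun a => u n ω (e a)) := by
    refine Prod.ext rfl (funext fun a => ?_)
    exact congrArg (u n ω (e a) - ·) (pastFilter_mulVec_pastVector Θ n e ω a).symm
  simpa only [h1] using h

/-- The covariance matrix of a finite stretch of the process is positive definite, so its Gaussian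
law has a density, in any linear coordinates. -/
lemma map_pastVector_absolutelyContinuous (hu : IsGaussianProcess u μ)
    (hmean : ∀ k a, ∫ ω, u k ω a ∂μ = 0) (hL : ∀ k a, MemLp (fun ω => u k ω a) 2 μ)
    {cmin cmax : ℝ} (hU : IsStationaryRiesz (coordLp hL) cmin cmax) (n : ℕ) {E : Type*}
    [NormedAddCommGroup E] [NormedSpace ℝ E] [MeasureSpace E] [BorelSpace E]
    [FiniteDimensional ℝ E] [(volume : Measure E).IsAddHaarMeasure]
    (ψ : (Fin n × σ → ℝ) ≃L[ℝ] E) : μ.map (fun ω => ψ (pastVector u n ω)) ≪ volume := by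
  classical
  have hg : HasGaussianLaw (pastVector u n) μ :=
    (hasGaussianLaw_pastVector_prod hu n (Fin.elim0 : Fin 0 → σ)).fst
  have hpos : (Matrix.of fun p p' : Fin n × σ =>
      ∫ ω, pastVector u n ω p * pastVector u n ω p' ∂μ).PosDef := by
    refine posDef_of_inner (e := fun p => coordLp hL (p.1 : ℕ) p.2)
      (fun a b => (inner_toLp _ _).symm) hU.cmin_pos fun c => ?_
    have hinj : Set.InjOn (fun j : Fin n => ((j : ℕ) : ℤ)) (Finset.univ : Finset (Fin n)) :=
      fun i _ j _ h => Fin.ext (by simpa using h)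
    have h := hU.lower (Finset.univ.image fun j : Fin n => ((j : ℕ) : ℤ))
      (fun k b => if h : k.toNat < n then c (⟨k.toNat, h⟩, b) else 0)
    rw [Finset.sum_image hinj, Finset.sum_image hinj] at h
    simpa [Fintype.sum_prod_type] using h
  obtain ⟨f, -, hf, -⟩ := exists_gaussian_density hg (fun p => hmean _ _) hpos fun _ _ => rfl
  have h1 : μ.map (pastVector u n) ≪ volume := hf ▸ withDensity_absolutelyContinuous _ _
  have h2 : μ.map (fun ω => ψ (pastVector u n ω)) = (μ.map (pastVector u n)).map ψ :=
    (AEMeasurable.map_map_of_aemeasurable ψ.continuous.measurable.aemeasurable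
      hg.aemeasurable).symm
  rw [h2]
  exact (h1.map ψ.continuous.measurable).trans (Measure.absolutelyContinuous_isAddHaarMeasure _ _)

/-- The conditional density of components of `u[n]` given the past `u[0:n]`, in any linear
coordinates `ψ` of that past, is the Gaussian density of the corresponding components of the
prediction error, whose covariance matrix is `G`. -/
lemma exists_log_condDensity [DecidableEq κ] (hu : IsGaussianProcess u μ)
    (hmean : ∀ k a, ∫ ω, u k ω a ∂μ = 0) (hL : ∀ k a, MemLp (fun ω => u k ω a) 2 μ)
    {cmin cmax : ℝ} (hU : IsStationaryRiesz (coordLp hL) cmin cmax) {n : ℕ}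
    {Θ : ℕ → Matrix σ σ ℝ} {G : Matrix σ σ ℝ} (hG : errorCov μ u (partialPrediction u Θ n) n = G)
    (hpos : G.PosDef) (horth : ∀ (j : ℕ) a b, j < n →
      ∫ ω, (u n ω a - partialPrediction u Θ n n ω a) * u j ω b ∂μ = 0)
    {e : κ → σ} (he : Function.Injective e) {E : Type*}
    [NormedAddCommGroup E] [NormedSpace ℝ E] [MeasureSpace E] [BorelSpace E]
    [FiniteDimensional ℝ E] [(volume : Measure E).IsAddHaarMeasure]
    (ψ : (Fin n × σ → ℝ) ≃L[ℝ] E) :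
    (μ.map fun ω => (ψ (pastVector u n ω), fun a => u n ω (e a))) ≪ volume ∧
    ∃ g : Ω → ℝ, Integrable g μ ∧
      ∫ ω, g ω ∂μ = -(1 / 2) * Real.log (G.submatrix e e).det +
        Fintype.card κ * (Real.log (√(2 * Real.pi))⁻¹ - 1 / 2) ∧
      ∀ᵐ ω ∂μ,
        condDensity μ (fun ω a => u n ω (e a)) (fun ω => ψ (pastVector u n ω))
          (fun a => u n ω (e a)) (ψ (pastVector u n ω)) ≠ 0 ∧
        Real.log (condDensity μ (fun ω a => u n ω (e a)) (fun ω => ψ (pastVector u n ω))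
          (fun a => u n ω (e a)) (ψ (pastVector u n ω))) = g ω := by
  have := hu.isProbabilityMeasure
  have : SecondCountableTopology E := inferInstance
  have hjoint := hasGaussianLaw_pastVector_residual hu Θ n e
  set N : Ω → κ → ℝ := fun ω a => u n ω (e a) - partialPrediction u Θ n n ω (e a) with hN
  have hNL (a : κ) : MemLp (fun ω => N ω a) 2 μ :=
    (hL n (e a)).sub (memLp_partialPrediction hL Θ n n (e a))
  have hNmean (a : κ) : ∫ ω, N ω a ∂μ = 0 := by
    simp only [hN, partialPrediction_apply]
    have h1 (i : ℕ) (b : σ) : Integrable (fun ω => Θ i (e a) b * u ((n : ℤ) - i) ω b) μ :=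
      ((hL _ b).integrable one_le_two).const_mul _
    rw [integral_sub ((hL n (e a)).integrable one_le_two)
      (integrable_finsetSum _ fun i _ => integrable_finsetSum _ fun b _ => h1 i b),
      integral_finsetSum _ fun i _ => integrable_finsetSum _ fun b _ => h1 i b]
    simp only [integral_finsetSum _ fun b _ => h1 _ b, integral_const_mul, hmean]
    simp
  have hind : IndepFun (pastVector u n) N μ := by
    refine HasGaussianLaw.indepFun_of_covariance_eval (X := fun p ω => pastVector u n ω p)
      (Y := fun a ω => N ω a) hjoint fun p a => ?_
    have hpL : MemLp (fun ω => pastVector u n ω p) 2 μ := hL _ _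
    rw [covariance_eq_sub hpL (hNL a), hNmean, mul_zero, sub_zero]
    rw [← horth p.1 (e a) p.2 p.1.2]
    exact integral_congr_ae (.of_forall fun ω => mul_comm _ _)
  obtain ⟨f, hfm, hf, hf0, hfi, hfint⟩ := exists_gaussian_density hjoint.snd hNmean
    (hpos.submatrix he) fun a b => by rw [← hG]; rfl
  have hψm : Measurable ψ := ψ.continuous.measurable
  have hA : Measurable fun x : E => pastFilter Θ n e *ᵥ ψ.symm x :=
    ((LinearMap.toContinuousLinearMap (pastFilter Θ n e).mulVecLin).continuous.comp
      ψ.symm.continuous).measurable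
  have hcd := condDensity_of_indep (X := fun ω => ψ (pastVector u n ω))
    (Y := fun ω a => u n ω (e a)) (N := N) hA (hψm.comp_aemeasurable hjoint.fst.aemeasurable)
    hjoint.snd.aemeasurable (fun ω => by
      funext a
      simp only [ContinuousLinearEquiv.symm_apply_apply, Pi.add_apply,
        pastFilter_mulVec_pastVector, hN, sub_add_cancel])
    (hind.comp hψm measurable_id) (map_pastVector_absolutelyContinuous hu hmean hL hU n ψ) hfm hf
  refine ⟨hcd.1, _, hfi, hfint, ?_⟩
  filter_upwards [hcd.2] with ω hω
  exact ⟨hω ▸ ENNReal.toReal_ne_zero.2 (hf0 _), by rw [hω]⟩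

end GaussianPrediction

/-! ### Coordinates on the finite past -/

section Segments

instance isAddHaarMeasure_volume_pi_pi {ι α : Type*} [Fintype ι] [Fintype α] :
    (volume : Measure (ι → α → ℝ)).IsAddHaarMeasure :=
  Measure.pi.isAddHaarMeasure fun _ : ι => (volume : Measure (α → ℝ))

lemma isAddHaarMeasure_volume_prod {E F : Type*} [NormedAddCommGroup E]
    [NormedAddCommGroup F] [MeasureSpace E] [MeasureSpace F] [BorelSpace E] [BorelSpace F]
    [SecondCountableTopology E] [SecondCountableTopology F]
    [SigmaFinite (volume : Measure E)] [SigmaFinite (volume : Measure F)]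
    [(volume : Measure E).IsAddHaarMeasure] [(volume : Measure F).IsAddHaarMeasure] :
    (volume : Measure (E × F)).IsAddHaarMeasure :=
  inferInstanceAs ((volume : Measure E).prod (volume : Measure F)).IsAddHaarMeasure

variable (n : ℕ) (α β γ : Type*) [Finite α] [Finite β] [Finite γ]

/-- Splitting the stretch of a stacked process `[a; b]` into the segments of `a` and `b`. -/
def segmentPairEquiv : (Fin n × (α ⊕ β) → ℝ) ≃L[ℝ] (Fin n → α → ℝ) × (Fin n → β → ℝ) :=
  LinearEquiv.toContinuousLinearEquiv
    { toFun := fun f => (fun j a => f (j, .inl a), fun j b => f (j, .inr b))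
      invFun := fun g p => Sum.elim (g.1 p.1) (g.2 p.1) p.2
      map_add' := fun _ _ => rfl
      map_smul' := fun _ _ => rfl
      left_inv := by
        intro f
        ext ⟨j, a | b⟩ <;> rfl
      right_inv := fun _ => rfl }

/-- Splitting the stretch of a stacked process `[a; b; c]` into its three segments, bracketed as the
conditioning variables in the definition of conditional mutual information. -/
def segmentTripleEquiv : (Fin n × (α ⊕ (β ⊕ γ)) → ℝ) ≃L[ℝ]
    (Fin n → α → ℝ) × ((Fin n → β → ℝ) × (Fin n → γ → ℝ)) :=
  LinearEquiv.toContinuousLinearEquiv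
    { toFun := fun f => (fun j a => f (j, .inl a),
        (fun j b => f (j, .inr (.inl b)), fun j c => f (j, .inr (.inr c))))
      invFun := fun g p => Sum.elim (g.1 p.1) (Sum.elim (g.2.1 p.1) (g.2.2 p.1)) p.2
      map_add' := fun _ _ => rfl
      map_smul' := fun _ _ => rfl
      left_inv := by
        intro f
        ext ⟨j, a | b | c⟩ <;> rfl
      right_inv := fun _ => rfl }

end Segments

lemma absolutelyContinuous_rotate {Ω E F G : Type*} [MeasurableSpace Ω] [MeasureSpace E]
    [MeasureSpace F] [MeasureSpace G] [SigmaFinite (volume : Measure E)]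
    [SigmaFinite (volume : Measure F)] [SigmaFinite (volume : Measure G)] {μ : Measure Ω}
    {X : Ω → E} {Y : Ω → F} {Z : Ω → G} (hm : AEMeasurable (fun ω => ((X ω, Z ω), Y ω)) μ)
    (h : (μ.map fun ω => ((X ω, Z ω), Y ω)) ≪ volume) :
    (μ.map fun ω => (X ω, Y ω, Z ω)) ≪ volume := by
  have h1 : MeasurePreserving (fun p : (E × G) × F => (p.1.1, p.2, p.1.2)) volume volume :=
    ((MeasurePreserving.id (volume : Measure E)).prod
      (Measure.measurePreserving_swap (μ := (volume : Measure G)) (ν := (volume : Measure F)))).comp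
      (volume_preserving_prodAssoc (α₁ := E) (β₁ := G) (γ₁ := F))
  have h2 : (μ.map fun ω => (X ω, Y ω, Z ω)) =
      (μ.map fun ω => ((X ω, Z ω), Y ω)).map fun p => (p.1.1, p.2, p.1.2) :=
    (AEMeasurable.map_map_of_aemeasurable h1.measurable.aemeasurable hm).symm
  rw [h2]
  exact (h.map h1.measurable).trans h1.map_eq.absolutelyContinuous

/-- Averages over `1 ≤ i < k` converge to the limit of the sequence. -/
lemma tendsto_average_Ico {t : ℕ → ℝ} {L : ℝ} (ht : Tendsto t atTop (𝓝 L)) :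
    Tendsto (fun k : ℕ => (1 / (k : ℝ)) * ∑ i ∈ Finset.Ico 1 k, t i) atTop (𝓝 L) := by
  have h1 := ht.cesaro.sub (tendsto_inv_atTop_nhds_zero_nat (𝕜 := ℝ) |>.mul_const (t 0))
  rw [zero_mul, sub_zero] at h1
  refine h1.congr' ?_
  filter_upwards [eventually_ge_atTop 1] with k hk
  rw [← Finset.sum_range_add_sum_Ico _ hk, Finset.sum_range_one]
  ring

end DirInfo

end

/-! ### The directed information rate -/

theorem theorem1 {Ω : Type*} [MeasurableSpace Ω] (μ : Measure Ω) [IsProbabilityMeasure μ]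
    {p q r : ℕ} (x : ℤ → Ω → Fin p → ℝ) (y : ℤ → Ω → Fin q → ℝ) (z : ℤ → Ω → Fin r → ℝ)
    (v : ℤ → Ω → (Fin q ⊕ Fin r) → ℝ) (hv : v = DirInfo.stack y z)
    (w : ℤ → Ω → (Fin p ⊕ (Fin q ⊕ Fin r)) → ℝ) (hw : w = DirInfo.stack x v)
    (hstat : DirInfo.IsStationary μ w)
    (hmean : ∀ k, ∫ ω, w k ω ∂μ = 0)
    (hgauss : IsGaussianProcess w μ)
    (cmin cmax : ℝ) (hcmin : 0 < cmin) (hcmax : 0 < cmax)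
    (hbounds : DirInfo.PSDBounds μ w cmin cmax)
    (hrational : DirInfo.RationalPSD μ w) :
    (∃ H what, DirInfo.IsOptimalPredictor μ w H what) ∧
    (∃ J vhat, DirInfo.IsOptimalPredictor μ v J vhat) ∧
    ∀ (H : ℕ → Matrix (Fin p ⊕ (Fin q ⊕ Fin r)) (Fin p ⊕ (Fin q ⊕ Fin r)) ℝ)
      (what : ℤ → Ω → (Fin p ⊕ (Fin q ⊕ Fin r)) → ℝ)
      (J : ℕ → Matrix (Fin q ⊕ Fin r) (Fin q ⊕ Fin r) ℝ)
      (vhat : ℤ → Ω → (Fin q ⊕ Fin r) → ℝ),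
      DirInfo.IsOptimalPredictor μ w H what →
      DirInfo.IsOptimalPredictor μ v J vhat →
      ∃ (Sigma : Matrix (Fin p ⊕ (Fin q ⊕ Fin r)) (Fin p ⊕ (Fin q ⊕ Fin r)) ℝ)
        (Gamma : Matrix (Fin q ⊕ Fin r) (Fin q ⊕ Fin r) ℝ),
        (∀ k, DirInfo.errorCov μ w what k = Sigma) ∧
        (∀ k, DirInfo.errorCov μ v vhat k = Gamma) ∧
        0 < Sigma.toBlocks₂₂.toBlocks₁₁.det ∧
        0 < Gamma.toBlocks₁₁.det ∧
        DirInfo.HasDirInfoRate μ x y z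
          (1 / 2 * Real.log (Gamma.toBlocks₁₁.det / Sigma.toBlocks₂₂.toBlocks₁₁.det)) := by
  have hwv (k ω b) : v k ω b = w k ω (.inr b) := by rw [hw]; rfl
  have hLw (k a) : MemLp (fun ω => w k ω a) 2 μ :=
    ((hgauss.hasGaussianLaw_eval k).eval a).memLp_two
  have hLv (k b) : MemLp (fun ω => v k ω b) 2 μ := by
    simpa only [hwv] using hLw k (.inr b)
  have hmw (k a) : ∫ ω, w k ω a ∂μ = 0 := by
    have h := congrFun (hmean k) a
    rwa [eval_integral fun b => (hLw k b).integrable one_le_two] at h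
  have hmv (k b) : ∫ ω, v k ω b ∂μ = 0 := by simpa only [hwv] using hmw k (.inr b)
  have hgv : IsGaussianProcess v μ := by
    let L : (Fin p ⊕ (Fin q ⊕ Fin r) → ℝ) →L[ℝ] (Fin q ⊕ Fin r → ℝ) :=
      ContinuousLinearMap.pi fun b => ContinuousLinearMap.proj (Sum.inr b)
    have h := hgauss.comp_left fun _ => L
    have h1 : v = fun k ω => L (w k ω) := by
      funext k ω b; exact hwv k ω b
    rw [h1]; exact h
  have hUw := DirInfo.isStationaryRiesz_coordLp hstat hLw hcmin hbounds
  have hUv : DirInfo.IsStationaryRiesz (DirInfo.coordLp hLv) cmin cmax := by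
    have h1 : DirInfo.coordLp hLv = fun k b => DirInfo.coordLp hLw k (.inr b) := by
      funext k b
      exact MemLp.toLp_congr _ _ (.of_forall fun ω => hwv k ω b)
    rw [h1]; exact hUw.restrict Sum.inr_injective
  refine ⟨DirInfo.exists_isOptimalPredictor hLw hUw, DirInfo.exists_isOptimalPredictor hLv hUv,
    fun H what J vhat hH hJ => ?_⟩
  obtain ⟨S, hS, hSpos, Θ, GS, hGS, hGSpos, hΘ, hGSlim⟩ := hH.exists_errorCov hLw hUw
  obtain ⟨C, hC, hCpos, Ξ, GC, hGC, hGCpos, hΞ, hGClim⟩ := hJ.exists_errorCov hLv hUv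
  have hiw : Function.Injective fun a : Fin q => (Sum.inr (Sum.inl a) : Fin p ⊕ (Fin q ⊕ Fin r)) :=
    Sum.inr_injective.comp Sum.inl_injective
  have hiv : Function.Injective fun a : Fin q => (Sum.inl a : Fin q ⊕ Fin r) :=
    Sum.inl_injective
  have hSdet : 0 < S.toBlocks₂₂.toBlocks₁₁.det := (hSpos.submatrix hiw).det_pos
  have hCdet : 0 < C.toBlocks₁₁.det := (hCpos.submatrix hiv).det_pos
  -- Each term is a difference of two Gaussian entropies, whose additive constants cancel.
  have hterm (i : ℕ) : DirInfo.DirInfoTermDefined μ x y z i ∧ DirInfo.dirInfoTerm μ x y z i =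
      1 / 2 * (Real.log ((GC i).submatrix Sum.inl Sum.inl).det -
        Real.log ((GS i).submatrix (fun a => Sum.inr (Sum.inl a))
          fun a => Sum.inr (Sum.inl a)).det) := by
    have hpair : (volume : Measure ((Fin i → Fin q → ℝ) × (Fin i → Fin r → ℝ))).IsAddHaarMeasure :=
      DirInfo.isAddHaarMeasure_volume_prod
    have htriple : (volume : Measure ((Fin i → Fin p → ℝ) ×
        ((Fin i → Fin q → ℝ) × (Fin i → Fin r → ℝ)))).IsAddHaarMeasure :=
      DirInfo.isAddHaarMeasure_volume_prod
    obtain ⟨hac, g, hg, hgi, hgae⟩ := DirInfo.exists_log_condDensity hgauss hmw hLw hUw (hGS i)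
      (hGSpos i) (hΘ i) hiw (DirInfo.segmentTripleEquiv i (Fin p) (Fin q) (Fin r))
    obtain ⟨-, g', hg', hgi', hgae'⟩ := DirInfo.exists_log_condDensity hgv hmv hLv hUv (hGC i)
      (hGCpos i) (hΞ i) hiv (DirInfo.segmentPairEquiv i (Fin q) (Fin r))
    have hmeas : AEMeasurable (fun ω => (DirInfo.segmentTripleEquiv i (Fin p) (Fin q) (Fin r)
        (DirInfo.pastVector w i ω), fun a : Fin q => w i ω (.inr (.inl a)))) μ :=
      ((DirInfo.segmentTripleEquiv i _ _ _).continuous.measurable.comp measurable_fst |>.prodMk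
        measurable_snd).comp_aemeasurable
        (DirInfo.hasGaussianLaw_pastVector_prod hgauss i _).aemeasurable
    subst hw hv
    have hae : DirInfo.condInfoDensity μ (DirInfo.segment x i) (y i)
        (fun ω => (DirInfo.segment y i ω, DirInfo.segment z i ω)) =ᵐ[μ] fun ω => g ω - g' ω := by
      filter_upwards [hgae, hgae'] with ω h1 h2
      rw [← h1.2, ← h2.2, ← Real.log_div h1.1 h2.1]
      rfl
    refine ⟨⟨DirInfo.absolutelyContinuous_rotate hmeas hac, (hg.sub hg').congr hae.symm⟩, ?_⟩
    rw [DirInfo.dirInfoTerm, DirInfo.condMutualInfo, integral_congr_ae hae, integral_sub hg hg',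
      hgi, hgi']
    ring
  refine ⟨S, C, hS, hC, hSdet, hCdet, fun i _ => (hterm i).1, ?_⟩
  simp only [DirInfo.causalDirInfo, fun i => (hterm i).2]
  refine DirInfo.tendsto_average_Ico ?_
  rw [Real.log_div hCdet.ne' hSdet.ne']
  refine Tendsto.const_mul _ (Tendsto.sub ?_ ?_)
  · refine Tendsto.log ?_ hCdet.ne'
    exact ((continuous_id.matrix_submatrix _ _).matrix_det.tendsto C).comp hGClim
  · refine Tendsto.log ?_ hSdet.ne'
    exact ((continuous_id.matrix_submatrix _ _).matrix_det.tendsto S).comp hGSlim
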